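/- Let $A\in \mathrm{SL}_3(\mathbb Z)$ have a real eigenvalue $\alpha>1$ and two non-real complex conjugate eigenvalues $\beta,\bar\beta$. Let $(a_1,a_2,a_3)^t\in\mathbb R^3\setminus\{0\}$ be an eigenvector of $A$ for $\alpha$ and $(b_1,b_2,b_3)^t\in\mathbb C^3\setminus\{0\}$ an eigenvector for $\beta$. Let $\mathbb H=\{w\in\mathbb C:\operatorname{Im} w>0\}$, let $G_A$ be the group of transformations of $\mathbb C\times\mathbb H$ generated by $(z,w)\mapsto(\beta z,\alpha w)$ and $(z,w)\mapsto(z+b_i,w+a_i)$, $i=1,2,3$, and let $\mathcal S^0=(\mathbb C\times\mathbb H)/G_A$ be the Inoue surface, a smooth manifold of real dimension $4$, with projection $\pi:\mathbb C\times\mathbb H\to\mathcal S^0$. For a closed smooth one-form $\eta$ on a manifold $M$, let $H^k_\eta(M)$ denote the Morse–Novikov cohomology, that is, the degree $k$ cohomology of the complex $(\Omega^\bullet(M), d_\eta)$ of smooth real forms with $d_\eta=d-\eta\wedge\cdot\,$. Then there is exactly one one-form $\theta$ on $\mathcal S^0$ (Tricerri's Lee form) with $\pi^*\theta=\frac{dw_2}{w_2}$,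 where $w_2=\operatorname{Im} w$. It is smooth and closed, and $\theta=\ln\alpha\cdot p^*\vartheta$, where $p:\mathcal S^0\to S^1$, $[z,w]\mapsto e^{2\pi \mathrm i\log_\alpha \operatorname{Im}w}$, and $\vartheta$ is the volume form of the circle normalized to total length $1$. Moreover $$H^1_\theta(\mathcal S^0)=0,\qquad H^2_\theta(\mathcal S^0)\simeq\mathbb R,\qquad H^3_\theta(\mathcal S^0)\simeq\mathbb R,$$ and all the other groups $H^k_\theta(\mathcal S^0)$, in particular $H^0_\theta(\mathcal S^0)$ and $H^4_\theta(\mathcal S^0)$, vanish. -/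

import Mathlib

open scoped Manifold ContDiff Topology Matrix

noncomputable section

namespace MorseNovikov

/-! ### Differential forms on a manifold modelled on a real normed space -/

section Forms

variable {E : Type*} [NormedAddCommGroup E] [NormedSpace ℝ E]
  {E' : Type*} [NormedAddCommGroup E'] [NormedSpace ℝ E']
  {M : Type*} [TopologicalSpace M] [ChartedSpace E M]
  {N : Type*} [TopologicalSpace N] [ChartedSpace E' N]

variable (E M) in
/-- Real-valued differential `k`-forms on `M`, with no regularity imposed. -/
def DForm (k : ℕ) : Type _ :=
  ∀ x : M, (TangentSpace 𝓘(ℝ, E) x) [⋀^Fin k]→L[ℝ] ℝ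

instance (k : ℕ) : AddCommGroup (DForm E M k) :=
  inferInstanceAs (AddCommGroup (∀ x : M, (TangentSpace 𝓘(ℝ, E) x) [⋀^Fin k]→L[ℝ] ℝ))

instance (k : ℕ) : Module ℝ (DForm E M k) :=
  inferInstanceAs (Module ℝ (∀ x : M, (TangentSpace 𝓘(ℝ, E) x) [⋀^Fin k]→L[ℝ] ℝ))
/-- The one-form with the given values, seen as an alternating form of degree one. -/
def oneForm (η : ∀ x : M, TangentSpace 𝓘(ℝ, E) x →L[ℝ] ℝ) : DForm E M 1 :=
  fun x => ContinuousAlternatingMap.ofSubsingleton ℝ (TangentSpace 𝓘(ℝ, E) x) ℝ (0 : Fin 1) (η x)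

/-- The pullback `f^* σ`. -/
def pullback {k : ℕ} (f : M → N) (σ : DForm E' N k) : DForm E M k :=
  fun x => (σ (f x)).compContinuousLinearMap (mfderiv 𝓘(ℝ, E) 𝓘(ℝ, E') f x)

/-- The expression of `σ` in a chart `e`, that is, `(e⁻¹)^* σ`, a form on (the target of `e` in)
the vector space `E`. -/
def chartRep {k : ℕ} (e : OpenPartialHomeomorph M E) (σ : DForm E M k) :
    E → E [⋀^Fin k]→L[ℝ] ℝ :=
  pullback (E := E) (M := E) e.symm σ

lemma chartRep_add {k : ℕ} (e : OpenPartialHomeomorph M E) (σ τ : DForm E M k) :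
    chartRep e (σ + τ) = chartRep e σ + chartRep e τ := rfl

lemma chartRep_smul {k : ℕ} (e : OpenPartialHomeomorph M E) (c : ℝ) (σ : DForm E M k) :
    chartRep e (c • σ) = c • chartRep e σ := rfl

variable (E M) in
/-- The space `Ω^k(M)` of smooth `k`-forms: those that are smooth in every chart of the atlas. -/
def smoothForms (k : ℕ) : Submodule ℝ (DForm E M k) where
  carrier := {σ | ∀ e ∈ atlas E M, ContDiffOn ℝ ∞ (chartRep e σ) e.target}
  zero_mem' := fun e _ => by
    have : chartRep e (0 : DForm E M k) = 0 := rfl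
    rw [this]; exact contDiffOn_const
  add_mem' := fun {σ τ} hσ hτ e he => by
    rw [chartRep_add]; exact (hσ e he).add (hτ e he)
  smul_mem' := fun c σ hσ e he => by
    rw [chartRep_smul]; exact (hσ e he).const_smul c

/-- The exterior derivative, computed at `x` in the preferred chart at `x`. -/
def extD {k : ℕ} (σ : DForm E M k) : DForm E M (k + 1) := fun x =>
  ContinuousAlternatingMap.compContinuousLinearMap
    (extDeriv (chartRep (chartAt E x) σ) (chartAt E x x))
    (mfderiv 𝓘(ℝ, E) 𝓘(ℝ, E) (chartAt E x) x)

/-- The wedge product `η ∧ σ` of a one-form with a `k`-form on a vector space: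
`(η ∧ σ)(v₀, …, v_k) = ∑ i, (-1)^i η(v_i) σ(v₀, …, v̂_i, …, v_k)`. -/
def wedgeAt {k : ℕ} (η : E [⋀^Fin 1]→L[ℝ] ℝ) (σ : E [⋀^Fin k]→L[ℝ] ℝ) :
    E [⋀^Fin (k + 1)]→L[ℝ] ℝ :=
  ContinuousAlternatingMap.alternatizeUncurryFin
    (((ContinuousAlternatingMap.ofSubsingleton ℝ E ℝ (0 : Fin 1)).symm η).smulRight σ)

lemma wedgeAt_add {k : ℕ} (η : E [⋀^Fin 1]→L[ℝ] ℝ) (σ τ : E [⋀^Fin k]→L[ℝ] ℝ) :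
    wedgeAt η (σ + τ) = wedgeAt η σ + wedgeAt η τ := by
  rw [wedgeAt, wedgeAt, wedgeAt, ← ContinuousAlternatingMap.alternatizeUncurryFin_add]
  congr 1
  ext v w
  simp

lemma wedgeAt_smul {k : ℕ} (η : E [⋀^Fin 1]→L[ℝ] ℝ) (c : ℝ) (σ : E [⋀^Fin k]→L[ℝ] ℝ) :
    wedgeAt η (c • σ) = c • wedgeAt η σ := by
  rw [wedgeAt, wedgeAt, ← ContinuousAlternatingMap.alternatizeUncurryFin_smul]
  congr 1
  ext v w
  simp
  ring

/-- The wedge product `η ∧ σ` of a one-form with a `k`-form on `M`. -/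
def wedgeOne {k : ℕ} (η : DForm E M 1) (σ : DForm E M k) : DForm E M (k + 1) :=
  fun x => wedgeAt (E := E) (η x) (σ x)

lemma differentiableAt_chartRep {k : ℕ} {σ : DForm E M k} (hσ : σ ∈ smoothForms E M k) (x : M) :
    DifferentiableAt ℝ (chartRep (chartAt E x) σ) (chartAt E x x) :=
  ((hσ _ (chart_mem_atlas E x)).contDiffAt
    ((chartAt E x).open_target.mem_nhds (mem_chart_target E x))).differentiableAt (by simp)

/-- The twisted differential `d_η σ = dσ - η ∧ σ` on smooth forms. -/
def twistedD (η : DForm E M 1) (k : ℕ) : smoothForms E M k →ₗ[ℝ] DForm E M (k + 1) where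
  toFun σ := extD σ.1 - wedgeOne η σ.1
  map_add' σ τ := by
    have h1 : extD (σ.1 + τ.1) = extD σ.1 + extD τ.1 := by
      funext x
      have := extDeriv_add (differentiableAt_chartRep σ.2 x) (differentiableAt_chartRep τ.2 x)
      simp only [extD, chartRep_add, this]
      rfl
    have h2 : wedgeOne η (σ.1 + τ.1) = wedgeOne η σ.1 + wedgeOne η τ.1 :=
      funext fun x => wedgeAt_add (E := E) (η x) (σ.1 x) (τ.1 x)
    show extD (σ.1 + τ.1) - wedgeOne η (σ.1 + τ.1) = _
    rw [h1, h2]; abel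
  map_smul' c σ := by
    have h1 : extD (c • σ.1) = c • extD σ.1 := by
      funext x
      simp only [extD, chartRep_smul, extDeriv_smul]
      rfl
    have h2 : wedgeOne η (c • σ.1) = c • wedgeOne η σ.1 :=
      funext fun x => wedgeAt_smul (E := E) (η x) c (σ.1 x)
    show extD (c • σ.1) - wedgeOne η (c • σ.1) = _
    rw [h1, h2, ← smul_sub]; rfl

/-- The `d_η`-closed smooth `k`-forms. -/
def cocycles (η : DForm E M 1) (k : ℕ) : Submodule ℝ (smoothForms E M k) :=
  LinearMap.ker (twistedD η k)

/-- The smooth `k`-forms that are `d_η` of a smooth `(k-1)`-form (only `0` when `k = 0`). -/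
def coboundaries (η : DForm E M 1) : (k : ℕ) → Submodule ℝ (smoothForms E M k)
  | 0 => ⊥
  | k + 1 => (LinearMap.range (twistedD η k)).comap (smoothForms E M (k + 1)).subtype

/-- The Morse–Novikov cohomology `H^k_η(M)`: the `d_η`-closed smooth `k`-forms modulo those among
them that are `d_η` of a smooth form. (For a closed smooth one-form `η` the map `d_η` preserves
smoothness and `d_η ∘ d_η = 0`, so this is the cohomology of the complex `(Ω^•(M), d_η)`.) -/
abbrev Cohomology [IsManifold 𝓘(ℝ, E) ∞ M] (η : DForm E M 1) (k : ℕ) : Type _ :=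
  cocycles η k ⧸ (coboundaries η k).submoduleOf (cocycles η k)

end Forms

end MorseNovikov

namespace Inoue

open MorseNovikov

/-- A matrix `A ∈ SL₃(ℤ)` with a real eigenvalue `α > 1` and a non-real eigenvalue `β` (hence also
`β̄`), a real eigenvector `a` for `α` and a complex eigenvector `b` for `β`. -/
structure InoueData where
  A : Matrix.SpecialLinearGroup (Fin 3) ℤ
  α : ℝ
  β : ℂ
  a : Fin 3 → ℝ
  b : Fin 3 → ℂ
  one_lt_α : 1 < α
  β_im_ne_zero : β.im ≠ 0
  a_ne_zero : a ≠ 0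
  b_ne_zero : b ≠ 0
  mulVec_a : A.1.map (Int.cast : ℤ → ℝ) *ᵥ a = α • a
  mulVec_b : A.1.map (Int.cast : ℤ → ℂ) *ᵥ b = β • b

/-- `ℂ × ℍ`, as an open subset of `ℂ × ℂ`. -/
def CH : TopologicalSpace.Opens (ℂ × ℂ) :=
  ⟨{q | 0 < q.2.im}, isOpen_lt continuous_const (Complex.continuous_im.comp continuous_snd)⟩

namespace InoueData

variable (D : InoueData)

lemma α_pos : 0 < D.α := zero_lt_one.trans D.one_lt_α

lemma β_ne_zero : D.β ≠ 0 := fun h => D.β_im_ne_zero (by simp [h])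

/-- The transformation `(z, w) ↦ (β z, α w)`. -/
def dilation : Equiv.Perm CH where
  toFun q := ⟨(D.β * q.1.1, D.α * q.1.2), by
    have := mul_pos D.α_pos q.2
    simpa [CH] using this⟩
  invFun q := ⟨(D.β⁻¹ * q.1.1, (D.α⁻¹ : ℝ) * q.1.2), by
    have := mul_pos (inv_pos.2 D.α_pos) q.2
    rw [← Complex.im_ofReal_mul] at this
    exact this⟩
  left_inv q := by
    have h := D.β_ne_zero
    have h' : (D.α : ℂ) ≠ 0 := by exact_mod_cast D.α_pos.ne'
    ext <;> simp [h, h']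
  right_inv q := by
    have h := D.β_ne_zero
    have h' : (D.α : ℂ) ≠ 0 := by exact_mod_cast D.α_pos.ne'
    ext <;> simp [h, h']

/-- The transformation `(z, w) ↦ (z + b_i, w + a_i)`. -/
def translation (i : Fin 3) : Equiv.Perm CH where
  toFun q := ⟨(q.1.1 + D.b i, q.1.2 + D.a i), by
    have := q.2
    simpa [CH] using this⟩
  invFun q := ⟨(q.1.1 - D.b i, q.1.2 - D.a i), by
    have := q.2
    simpa [CH] using this⟩
  left_inv q := by ext <;> simp
  right_inv q := by ext <;> simp

/-- The group `G_A` of transformations of `ℂ × ℍ`. -/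
def G : Subgroup (Equiv.Perm CH) :=
  Subgroup.closure ({D.dilation} ∪ Set.range D.translation)

/-! #### Explicit form of the elements of `G_A` -/


lemma zpow_mulVec {K : Type*} [Field K] (A : Matrix.SpecialLinearGroup (Fin 3) ℤ) {c : K}
    (hc : c ≠ 0) {v : Fin 3 → K} (h : A.1.map (Int.cast : ℤ → K) *ᵥ v = c • v) (n : ℤ) :
    (A ^ n).1.map (Int.cast : ℤ → K) *ᵥ v = c ^ n • v := by
  have hmul (P Q : Matrix.SpecialLinearGroup (Fin 3) ℤ) :
      (P * Q).1.map (Int.cast : ℤ → K) = P.1.map Int.cast * Q.1.map Int.cast := by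
    have := Matrix.map_mul (L := P.1) (M := Q.1) (f := Int.castRingHom K)
    simpa using this
  have hone : (1 : Matrix.SpecialLinearGroup (Fin 3) ℤ).1.map (Int.cast : ℤ → K) = 1 := by
    simp
  have hinv : (A⁻¹).1.map (Int.cast : ℤ → K) *ᵥ v = c⁻¹ • v := by
    have h1 : (A⁻¹).1.map (Int.cast : ℤ → K) *ᵥ (A.1.map (Int.cast : ℤ → K) *ᵥ v) = v := by
      rw [Matrix.mulVec_mulVec, ← hmul, inv_mul_cancel, hone, Matrix.one_mulVec]
    rw [h, Matrix.mulVec_smul] at h1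
    rw [← h1, smul_smul, inv_mul_cancel₀ hc, one_smul, h1]
  induction n using Int.induction_on with
  | zero => simp
  | succ n ih =>
    rw [zpow_add_one, hmul, ← Matrix.mulVec_mulVec, h, Matrix.mulVec_smul, ih, smul_smul,
      zpow_add_one₀ hc, mul_comm]
  | pred n ih =>
    rw [zpow_sub_one, hmul, ← Matrix.mulVec_mulVec, hinv, Matrix.mulVec_smul, ih, smul_smul,
      zpow_sub_one₀ hc, mul_comm]

lemma zpow_sum {K : Type*} [Field K] (A : Matrix.SpecialLinearGroup (Fin 3) ℤ) {c : K}
    (hc : c ≠ 0) {v : Fin 3 → K} (h : A.1.map (Int.cast : ℤ → K) *ᵥ v = c • v) (n : ℤ)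
    (m : Fin 3 → ℤ) :
    c ^ n * ∑ i, (m i : K) * v i = ∑ j, (((m ᵥ* (A ^ n).1) j : ℤ) : K) * v j := by
  have key := zpow_mulVec A hc h n
  calc c ^ n * ∑ i, (m i : K) * v i = ∑ i, (m i : K) * (c ^ n • v) i := by
        rw [Finset.mul_sum]
        exact Finset.sum_congr rfl fun i _ => by simp only [Pi.smul_apply, smul_eq_mul]; ring
    _ = ∑ i, ∑ j, (m i : K) * (((A ^ n).1 i j : K) * v j) := by
        rw [← key]
        refine Finset.sum_congr rfl fun i _ => ?_
        simp only [Matrix.mulVec, dotProduct, Matrix.map_apply, Finset.mul_sum]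
    _ = _ := by
        rw [Finset.sum_comm]
        refine Finset.sum_congr rfl fun j _ => ?_
        simp only [Matrix.vecMul, dotProduct, Int.cast_sum, Int.cast_mul, Finset.sum_mul]
        exact Finset.sum_congr rfl fun i _ => by ring

/-- `(n, m)` describes `g`: it is `(z, w) ↦ (βⁿ z + ∑ mᵢ bᵢ, αⁿ w + ∑ mᵢ aᵢ)`. -/
def Describes (g : Equiv.Perm CH) (n : ℤ) (m : Fin 3 → ℤ) : Prop :=
  ∀ q : CH, (g q : ℂ × ℂ) =
    (D.β ^ n * q.1.1 + ∑ i, (m i : ℂ) * D.b i,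
      ((D.α ^ n : ℝ) : ℂ) * q.1.2 + ((∑ i, (m i : ℝ) * D.a i : ℝ) : ℂ))

lemma Describes.one : D.Describes 1 0 0 := fun q => by simp

lemma Describes.mul {D : InoueData} {g h : Equiv.Perm CH} {n n' : ℤ} {m m' : Fin 3 → ℤ}
    (hg : D.Describes g n m) (hh : D.Describes h n' m') :
    D.Describes (g * h) (n + n') (m' ᵥ* (D.A ^ n).1 + m) := fun q => by
  have h1 := zpow_sum D.A D.β_ne_zero D.mulVec_b n m'
  have h2 := zpow_sum D.A D.α_pos.ne' D.mulVec_a n m'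
  rw [Equiv.Perm.mul_apply, hg, hh]
  refine Prod.ext ?_ ?_
  · simp only [Pi.add_apply, Int.cast_add, add_mul, Finset.sum_add_distrib, ← h1,
      zpow_add₀ D.β_ne_zero]
    ring
  · simp only [Pi.add_apply, Int.cast_add, add_mul, Finset.sum_add_distrib, ← h2,
      zpow_add₀ D.α_pos.ne']
    push_cast
    ring

lemma Describes.inv {D : InoueData} {g : Equiv.Perm CH} {n : ℤ} {m : Fin 3 → ℤ}
    (hg : D.Describes g n m) :
    D.Describes g⁻¹ (-n) (-(m ᵥ* (D.A ^ (-n)).1)) := fun q => by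
  have h1 := zpow_sum D.A D.β_ne_zero D.mulVec_b (-n) m
  have h2 := zpow_sum D.A D.α_pos.ne' D.mulVec_a (-n) m
  have hα : (D.α : ℂ) ≠ 0 := by exact_mod_cast D.α_pos.ne'
  obtain ⟨p, rfl⟩ := g.surjective q
  have hp : g⁻¹ (g p) = p := Equiv.symm_apply_apply g p
  rw [hp, hg]
  refine Prod.ext ?_ ?_
  · simp only [Pi.neg_apply, Int.cast_neg, neg_mul, Finset.sum_neg_distrib, ← h1]
    rw [zpow_neg]
    field_simp [zpow_ne_zero n D.β_ne_zero]
    ring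
  · simp only [Pi.neg_apply, Int.cast_neg, neg_mul, Finset.sum_neg_distrib, ← h2]
    rw [zpow_neg]
    push_cast
    field_simp [zpow_ne_zero n hα]
    ring

lemma exists_describes {g : Equiv.Perm CH} (hg : g ∈ D.G) : ∃ n m, D.Describes g n m := by
  induction hg using Subgroup.closure_induction with
  | mem x hx =>
    rcases hx with hx | ⟨i, rfl⟩
    · obtain rfl : x = D.dilation := hx
      exact ⟨1, 0, fun q => by simp [dilation]⟩
    · exact ⟨0, Pi.single i 1, fun q => by
        simp [translation, Pi.single_apply, apply_ite (Int.cast : ℤ → ℂ),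
          apply_ite (Int.cast : ℤ → ℝ)]⟩
  | one => exact ⟨0, 0, Describes.one D⟩
  | mul x y _ _ hx hy =>
    obtain ⟨n, m, h⟩ := hx
    obtain ⟨n', m', h'⟩ := hy
    exact ⟨_, _, h.mul h'⟩
  | inv x _ hx =>
    obtain ⟨n, m, h⟩ := hx
    exact ⟨_, _, h.inv⟩

/-- The real linear map `x ↦ (∑ xᵢ bᵢ, ∑ xᵢ aᵢ)`. -/
def period : (Fin 3 → ℝ) →ₗ[ℝ] ℂ × ℝ :=
  LinearMap.prod (∑ i, (LinearMap.proj i).smulRight (D.b i))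
    (∑ i, (LinearMap.proj i).smulRight (D.a i))

lemma period_apply (x : Fin 3 → ℝ) :
    D.period x = (∑ i, (x i : ℂ) * D.b i, ∑ i, x i * D.a i) := by
  simp [period]

lemma ker_period : LinearMap.ker D.period = ⊥ := by
  rw [LinearMap.ker_eq_bot']
  intro x hx
  rw [period_apply, Prod.mk_eq_zero] at hx
  obtain ⟨h1, h2⟩ := hx
  let T : Module.End ℂ (Fin 3 → ℂ) := Matrix.toLin' (D.A.1.map (Int.cast : ℤ → ℂ))
  let μ : Fin 3 → ℂ := ![D.α, D.β, star D.β]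
  let v : Fin 3 → (Fin 3 → ℂ) := ![fun i => (D.a i : ℂ), D.b, fun i => star (D.b i)]
  have hμ : Function.Injective μ := by
    have e1 : (D.α : ℂ) ≠ D.β := fun h => D.β_im_ne_zero (by simp [← h])
    have e2 : (D.α : ℂ) ≠ star D.β := fun h => D.β_im_ne_zero (by
      have := congrArg Complex.im h; simpa using this)
    have e3 : D.β ≠ star D.β := fun h => D.β_im_ne_zero (by
      have := congrArg Complex.im h
      simp at this
      linarith)
    intro i j hij
    fin_cases i <;> fin_cases j <;> simp_all [μ]
  have hv : ∀ i, T.HasEigenvector (μ i) (v i) := by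
    have ha := congrFun D.mulVec_a
    have hb := congrFun D.mulVec_b
    simp only [Matrix.mulVec, dotProduct, Matrix.map_apply, Pi.smul_apply, smul_eq_mul] at ha hb
    intro i
    rw [Module.End.hasEigenvector_iff, Module.End.mem_eigenspace_iff]
    fin_cases i
    · refine ⟨funext fun i => ?_, fun h => D.a_ne_zero (funext fun i => ?_)⟩
      · have := congrArg (Complex.ofReal) (ha i)
        push_cast at this
        simpa [T, v, μ, Matrix.mulVec, dotProduct] using this
      · have := congrFun h i
        simpa [v] using this
    · refine ⟨funext fun i => ?_, D.b_ne_zero⟩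
      simpa [T, v, μ, Matrix.mulVec, dotProduct] using hb i
    · refine ⟨funext fun i => ?_, fun h => D.b_ne_zero (funext fun i => ?_)⟩
      · have := congrArg (starRingEnd ℂ) (hb i)
        simp only [map_sum, map_mul, map_intCast] at this
        simpa [T, v, μ, Matrix.mulVec, dotProduct] using this
      · have := congrFun h i
        simpa [v] using this
  have hli := Module.End.eigenvectors_linearIndependent' T μ hμ v hv
  have hx' : Matrix.of v *ᵥ (fun i => (x i : ℂ)) = 0 := by
    have h1' := congrArg (starRingEnd ℂ) h1
    have h2' := congrArg Complex.ofReal h2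
    simp only [map_sum, map_mul, Complex.conj_ofReal, map_zero] at h1'
    push_cast at h2'
    funext j
    fin_cases j
    · simpa [v, Matrix.mulVec, dotProduct, mul_comm] using h2'
    · simpa [v, Matrix.mulVec, dotProduct, mul_comm] using h1
    · simpa [v, Matrix.mulVec, dotProduct, mul_comm] using h1'
  have hunit : IsUnit (Matrix.of v) := Matrix.linearIndependent_rows_iff_isUnit.1 hli
  have := Matrix.mulVec_injective_iff_isUnit.2 hunit (hx'.trans (Matrix.mulVec_zero _).symm)
  funext i
  simpa using congrFun this i

lemma finite_period_le (R : ℝ) :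
    {m : Fin 3 → ℤ | ‖D.period (fun i => (m i : ℝ))‖ ≤ R}.Finite := by
  obtain ⟨K, -, hK⟩ := D.period.exists_antilipschitzWith D.ker_period
  refine Set.Finite.subset
    (isCompact_closedBall (0 : Fin 3 → ℤ) (K * R)).finite_of_discrete fun m hm => ?_
  have h1 := hK.le_mul_dist (fun i => (m i : ℝ)) 0
  rw [map_zero, dist_zero_right, dist_zero_right] at h1
  have h2 : ‖m‖ ≤ ‖fun i => (m i : ℝ)‖ := by
    refine (pi_norm_le_iff_of_nonneg (norm_nonneg _)).2 fun i => ?_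
    have := norm_le_pi_norm (fun i => (m i : ℝ)) i
    simpa [Int.norm_eq_abs] using this
  rw [mem_closedBall_zero_iff]
  exact h2.trans (h1.trans (mul_le_mul_of_nonneg_left hm K.2))

lemma Describes.im {D : InoueData} {g : Equiv.Perm CH} {n : ℤ} {m : Fin 3 → ℤ}
    (h : D.Describes g n m) (q : CH) : (g q).1.2.im = D.α ^ n * q.1.2.im := by
  rw [h q]
  simp only [Complex.add_im, Complex.im_ofReal_mul, Complex.ofReal_im, add_zero]

instance : ContinuousConstSMul D.G CH where
  continuous_const_smul g := by
    obtain ⟨n, m, h⟩ := D.exists_describes g.2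
    refine Continuous.subtype_mk (f := fun q => ((g.1 q : CH) : ℂ × ℂ)) ?_ _
    simp only [h _]
    fun_prop

instance : IsCancelSMul D.G CH := by
  rw [isCancelSMul_iff_eq_one_of_smul_eq]
  intro g q hq
  obtain ⟨n, m, h⟩ := D.exists_describes g.2
  have hq' : g.1 q = q := hq
  have him := h.im q
  rw [hq'] at him
  have hpos : (0 : ℝ) < q.1.2.im := q.2
  have hn : D.α ^ n = 1 := by
    have : (D.α ^ n - 1) * q.1.2.im = 0 := by linarith
    rcases mul_eq_zero.1 this with h | h
    · linarith
    · exact absurd h hpos.ne'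
  have hn0 : n = 0 := (zpow_eq_one_iff_right₀ D.α_pos.le D.one_lt_α.ne').1 hn
  subst hn0
  have hc := h q
  rw [hq'] at hc
  have hc1 := congrArg Prod.fst hc
  have hc2 := congrArg Prod.snd hc
  simp only [zpow_zero, one_mul, left_eq_add, Complex.ofReal_one] at hc1 hc2
  refine Subtype.ext (Equiv.ext fun p => Subtype.ext ?_)
  rw [h p, hc1, hc2]
  simp

lemma finite_zpow (c C : ℝ) (hc : 0 < c) : {n : ℤ | c ≤ D.α ^ n ∧ D.α ^ n ≤ C}.Finite := by
  have hlog : 0 < Real.log D.α := Real.log_pos D.one_lt_α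
  refine (Set.finite_Icc ⌊Real.log c / Real.log D.α⌋ ⌈Real.log C / Real.log D.α⌉).subset ?_
  rintro n ⟨h1, h2⟩
  have hp : 0 < D.α ^ n := zpow_pos D.α_pos n
  have l1 := Real.log_le_log hc h1
  have l2 := Real.log_le_log hp h2
  rw [Real.log_zpow] at l1 l2
  rw [← div_le_iff₀ hlog] at l1
  rw [← le_div_iff₀ hlog] at l2
  constructor
  · exact_mod_cast (Int.floor_le _).trans l1
  · exact_mod_cast l2.trans (Int.le_ceil _)

instance : ProperlyDiscontinuousSMul D.G CH where
  finite_disjoint_inter_image := by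
    intro K L hK hL
    rcases K.eq_empty_or_nonempty with rfl | hKne
    · simp
    rcases L.eq_empty_or_nonempty with rfl | hLne
    · simp
    have him : Continuous fun q : CH => q.1.2.im := by fun_prop
    have hnorm : Continuous fun q : CH => ‖q.1‖ := by fun_prop
    obtain ⟨k₀, -, hk₀⟩ := hK.exists_isMinOn hKne him.continuousOn
    obtain ⟨k₁, -, hk₁⟩ := hK.exists_isMaxOn hKne him.continuousOn
    obtain ⟨k₂, -, hk₂⟩ := hK.exists_isMaxOn hKne hnorm.continuousOn
    obtain ⟨l₀, -, hl₀⟩ := hL.exists_isMinOn hLne him.continuousOn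
    obtain ⟨l₁, -, hl₁⟩ := hL.exists_isMaxOn hLne him.continuousOn
    obtain ⟨l₂, -, hl₂⟩ := hL.exists_isMaxOn hLne hnorm.continuousOn
    choose F₁ F₂ hF using fun g : D.G => D.exists_describes g.2
    have hinj : Function.Injective fun g => (F₁ g, F₂ g) := by
      intro g g' h
      simp only [Prod.mk.injEq] at h
      refine Subtype.ext (Equiv.ext fun p => Subtype.ext ?_)
      rw [hF g p, hF g' p, h.1, h.2]
    refine Set.Finite.of_finite_image ?_ hinj.injOn
    have p0 : ∀ q : CH, (0 : ℝ) < q.1.2.im := fun q => q.2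
    have hN := D.finite_zpow (l₀.1.2.im / k₁.1.2.im) (l₁.1.2.im / k₀.1.2.im)
      (div_pos (p0 _) (p0 _))
    refine Set.Finite.subset (hN.biUnion fun n _ =>
      (D.finite_period_le (‖l₂.1‖ + (‖D.β ^ n‖ + ‖D.α ^ n‖) * ‖k₂.1‖)).image fun m => (n, m)) ?_
    rintro _ ⟨g, ⟨_, ⟨q, hq, rfl⟩, hgq⟩, rfl⟩
    have hgq' : g.1 q ∈ L := hgq
    have e := (hF g).im q
    have b1 : k₀.1.2.im ≤ q.1.2.im := hk₀ hq
    have b2 : q.1.2.im ≤ k₁.1.2.im := hk₁ hq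
    have b3 : l₀.1.2.im ≤ (g.1 q).1.2.im := hl₀ hgq'
    have b4 : (g.1 q).1.2.im ≤ l₁.1.2.im := hl₁ hgq'
    have b5 : ‖q.1‖ ≤ ‖k₂.1‖ := hk₂ hq
    have b6 : ‖(g.1 q).1‖ ≤ ‖l₂.1‖ := hl₂ hgq'
    have hp : 0 < D.α ^ F₁ g := zpow_pos D.α_pos _
    simp only [Set.mem_iUnion]
    refine ⟨F₁ g, ⟨?_, ?_⟩, F₂ g, ?_, rfl⟩
    · rw [div_le_iff₀ (p0 _)]
      exact b3.trans (e.le.trans (mul_le_mul_of_nonneg_left b2 hp.le))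
    · rw [le_div_iff₀ (p0 _)]
      exact (mul_le_mul_of_nonneg_left b1 hp.le).trans (e.ge.trans b4)
    · have hd := hF g q
      have d1 := congrArg Prod.fst hd
      have d2 := congrArg Prod.snd hd
      simp only at d1 d2
      rw [Set.mem_ofPred_eq, period_apply, Prod.norm_def]
      have n1 := norm_fst_le q.1
      have n2 := norm_snd_le q.1
      have n3 := norm_fst_le (g.1 q).1
      have n4 := norm_snd_le (g.1 q).1
      have q0 := norm_nonneg q.1
      refine max_le ?_ ?_
      · have : ∑ i, (((F₂ g i : ℤ) : ℝ) : ℂ) * D.b i = (g.1 q).1.1 - D.β ^ F₁ g * q.1.1 := by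
          rw [d1]; push_cast; ring
        rw [this]
        refine (norm_sub_le _ _).trans (add_le_add (n3.trans b6) ?_)
        rw [norm_mul]
        exact mul_le_mul (le_add_of_nonneg_right (norm_nonneg _)) (n1.trans b5)
          (norm_nonneg _) (by positivity)
      · have : ((∑ i, (F₂ g i : ℝ) * D.a i : ℝ) : ℂ)
            = (g.1 q).1.2 - ((D.α ^ F₁ g : ℝ) : ℂ) * q.1.2 := by
          rw [d2]; ring
        rw [← Complex.norm_real, this]
        refine (norm_sub_le _ _).trans (add_le_add (n4.trans b6) ?_)
        rw [norm_mul, Complex.norm_real]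
        exact mul_le_mul (le_add_of_nonneg_left (norm_nonneg _)) (n2.trans b5)
          (norm_nonneg _) (by positivity)

instance : LocallyCompactSpace CH := CH.isOpen.locallyCompactSpace

/-- The Inoue surface `S⁰ = (ℂ × ℍ) / G_A`, with the quotient topology and the atlas pushed forward
from `ℂ × ℍ` by local inverses of the projection. -/
abbrev S0 : Type := MulAction.orbitRel.Quotient D.G CH

/-- The projection `ℂ × ℍ → S⁰`. -/
def proj : CH → D.S0 := Quotient.mk _

lemma isLocalHomeomorph_proj : IsLocalHomeomorph D.proj :=
  isQuotientCoveringMap_quotientMk_of_properlyDiscontinuousSMul.isCoveringMap.isLocalHomeomorph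

lemma exists_of_mem_atlas {e : OpenPartialHomeomorph D.S0 (ℂ × ℂ)} (he : e ∈ atlas (ℂ × ℂ) D.S0) :
    ∃ q : CH, e = (D.isLocalHomeomorph_proj.localInverseAt q).trans (chartAt (ℂ × ℂ) q) := by
  obtain ⟨x, rfl⟩ := he
  exact ⟨_, rfl⟩

instance : IsManifold 𝓘(ℝ, ℂ × ℂ) ∞ D.S0 := by
  refine isManifold_of_contDiffOn _ _ _ fun e e' he he' => ?_
  obtain ⟨q, rfl⟩ := D.exists_of_mem_atlas he
  obtain ⟨q', rfl⟩ := D.exists_of_mem_atlas he'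
  set i := D.isLocalHomeomorph_proj.localInverseAt q with hi
  set i' := D.isLocalHomeomorph_proj.localInverseAt q' with hi'
  have hic : i.symm = D.proj := D.isLocalHomeomorph_proj.localInverseAt_symm q
  have hic' : i'.symm = D.proj := D.isLocalHomeomorph_proj.localInverseAt_symm q'
  have hsymm : ∀ y ∈ (chartAt (ℂ × ℂ) q).target, (((chartAt (ℂ × ℂ) q).symm y : CH) : ℂ × ℂ) = y :=
    fun y hy => (chartAt (ℂ × ℂ) q).right_inv hy
  intro y hy
  obtain ⟨hy, -⟩ := hy
  simp only [mfld_simps] at hy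
  obtain ⟨⟨hy1, hy2⟩, hy3⟩ := hy
  set p : CH := (chartAt (ℂ × ℂ) q).symm y with hp
  rw [hic] at hy3
  -- the two lifts of the point differ by an element of the group
  have hpi : D.proj (i' (D.proj p)) = D.proj p := by
    have := i'.left_inv hy3.1
    rwa [hic'] at this
  obtain ⟨g, hg⟩ : ∃ g : D.G, g • p = i' (D.proj p) := Quotient.exact hpi
  obtain ⟨n, m, h⟩ := D.exists_describes g.2
  have hcont : ContinuousAt (fun y => g • (chartAt (ℂ × ℂ) q).symm y) y :=
    (continuous_const_smul g).continuousAt.comp ((chartAt (ℂ × ℂ) q).continuousAt_symm hy1)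
  have hmem : i'.target ∈ 𝓝 (g • (chartAt (ℂ × ℂ) q).symm y) := by
    rw [← hp, hg]
    exact i'.open_target.mem_nhds (i'.map_source hy3.1)
  have hev : ∀ᶠ u in 𝓝 y, u ∈ (chartAt (ℂ × ℂ) q).target ∧
      g • (chartAt (ℂ × ℂ) q).symm u ∈ i'.target :=
    ((chartAt (ℂ × ℂ) q).open_target.mem_nhds hy1 |> Filter.Eventually.and) (hcont hmem)
  refine ContDiffAt.contDiffWithinAt ?_
  refine ContDiffAt.congr_of_eventuallyEq (f := fun u : ℂ × ℂ =>
    (D.β ^ n * u.1 + ∑ i, (m i : ℂ) * D.b i,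
      ((D.α ^ n : ℝ) : ℂ) * u.2 + ((∑ i, (m i : ℝ) * D.a i : ℝ) : ℂ))) (by fun_prop) ?_
  filter_upwards [hev] with u hu
  have e1 : D.proj ((chartAt (ℂ × ℂ) q).symm u) = D.proj (g • (chartAt (ℂ × ℂ) q).symm u) :=
    Quotient.sound ⟨g⁻¹, inv_smul_smul g _⟩
  have e2 : i' (D.proj (g • (chartAt (ℂ × ℂ) q).symm u)) = g • (chartAt (ℂ × ℂ) q).symm u := by
    have := i'.right_inv hu.2
    rwa [hic'] at this
  have e3 := h ((chartAt (ℂ × ℂ) q).symm u)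
  rw [hsymm u hu.1] at e3
  simp only [mfld_simps]
  rw [hic, e1, e2]
  exact e3

/-- The one-form `dw₂ / w₂` on `ℂ × ℍ`, with `w₂ = Im w`. -/
def tricerriForm : DForm (ℂ × ℂ) CH 1 :=
  oneForm fun q => (q.1.2.im)⁻¹ • mfderiv 𝓘(ℝ, ℂ × ℂ) 𝓘(ℝ, ℝ) (fun p : CH => p.1.2.im) q

/-- The fibration `p : S⁰ → S¹`, `[z, w] ↦ exp (2πi log_α (Im w))`. -/
def fibration : D.S0 → Circle :=
  Quotient.lift (fun q : CH => Circle.exp (2 * Real.pi * Real.logb D.α q.1.2.im)) <| by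
    rintro q q' ⟨g, rfl⟩
    obtain ⟨n, m, h⟩ := D.exists_describes g.2
    have h1 : (0 : ℝ) < q'.1.2.im := q'.2
    have h2 := h.im q'
    show Circle.exp (2 * Real.pi * Real.logb D.α (g.1 q').1.2.im) = _
    rw [h2, Real.logb_mul (zpow_pos D.α_pos n).ne' h1.ne', ← Real.rpow_intCast,
      Real.logb_rpow D.α_pos D.one_lt_α.ne', mul_add, add_comm, mul_comm (2 * Real.pi) (n : ℝ)]
    exact Circle.periodic_exp.int_mul n _

end InoueData

/-- The volume form of the circle of length one: `dφ / 2π`, where `φ` is the angle. -/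
def circleForm : DForm (EuclideanSpace ℝ (Fin 1)) Circle 1 :=
  oneForm fun z => (2 * Real.pi)⁻¹ • (Complex.imCLM ∘L
    ContinuousLinearMap.mul ℝ ℂ ((z⁻¹ : Circle) : ℂ) ∘L
      mfderiv (𝓡 1) 𝓘(ℝ, ℂ) (fun u : Circle => (u : ℂ)) z)

end Inoue

end

/-!
The coordinates `(z, x + i y) ↦ (z, x + i α ^ y)` identify `ℂ × ℍ` with the vector space `ℂ × ℂ`,
and the Lee form lifts to `log α • dy`. Dividing the lift of a form by `α ^ y` therefore turns
`d_θ` into `d`, and identifies the twisted complex of `S⁰` with the complex of those forms on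
`ℂ × ℂ` that are periodic under the translation lattice `ℤ³` and fixed by `T`, the pullback by the
remaining generator `(z, x + i y) ↦ (β z, α x + i (y + 1))` multiplied by `α`.

Averaging over the torus `ℝ³ / ℤ³` shows that a closed periodic form is, up to the differential of a
periodic form, a constant form without `dy`. On periodic forms `1 - T` is surjective: cut a form off
by a partition of unity in `y` and sum the series of its iterates under `T` and `T⁻¹`, which is
locally finite. As in Wang's exact sequence of a mapping torus, the cohomology is therefore computed
by the kernel and the cokernel of `1 - T` on the constant forms without `dy`. There `T` has
eigenvalue `1` only on the area form of the `z`-plane, with multiplicity one, because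
`α |β| ^ 2 = 1`. The kernel contributes the area form itself, in degree two, and the cokernel the
differential of `y` times the area form, in degree three.
-/

noncomputable section

/-! ### Averages along a line -/

namespace MorseNovikov

section Alternatization

variable {ι : Type*} [Fintype ι]
  {E : Type*} [NormedAddCommGroup E] [NormedSpace ℝ E]
  {F : Type*} [NormedAddCommGroup F] [NormedSpace ℝ F]

/-- The antisymmetrization `f ↦ (1 / k!) ∑ σ, sign σ • f ∘ σ` of continuous multilinear maps in `k`
variables, normalized so as to be a retraction onto the alternating ones. -/
def antisymmetrization [DecidableEq ι] :
    ContinuousMultilinearMap ℝ (fun _ : ι => E) F →L[ℝ] E [⋀^ι]→L[ℝ] F :=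
  ((Fintype.card ι).factorial : ℝ)⁻¹ • ContinuousAlternatingMap.liftCLM
    (∑ σ : Equiv.Perm ι, (Equiv.Perm.sign σ : ℤ) •
      ((ContinuousMultilinearMap.domDomCongrₗᵢ ℝ E F σ).toContinuousLinearEquiv : _ →L[ℝ] _))
    fun f v i j hij hne => by
      have h := (MultilinearMap.alternatization f.toMultilinearMap).map_eq_zero_of_eq v hij hne
      rw [MultilinearMap.alternatization_apply] at h
      rwa [sum_apply, sum_apply]

lemma antisymmetrization_toContinuousMultilinearMap [DecidableEq ι] (c : E [⋀^ι]→L[ℝ] F) :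
    antisymmetrization c.toContinuousMultilinearMap = c := by
  have hsum (v : ι → E) : ∑ σ : Equiv.Perm ι, Equiv.Perm.sign σ • c (v ∘ σ) =
      (Fintype.card ι).factorial • c v := by
    have h := congrArg (· v) (AlternatingMap.coe_alternatization c.toAlternatingMap)
    rwa [MultilinearMap.alternatization_apply] at h
  ext v
  have h : ((Fintype.card ι).factorial : ℝ) ≠ 0 := by positivity
  rw [← inv_smul_smul₀ h (c v), Nat.cast_smul_eq_nsmul, ← hsum, antisymmetrization,
    smul_apply, ContinuousAlternatingMap.smul_apply,
    ContinuousAlternatingMap.liftCLM_apply, sum_apply, sum_apply]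
  rfl

lemma contDiffAt_compContinuousLinearMap {E' G : Type*} [NormedAddCommGroup E'] [NormedSpace ℝ E']
    [NormedAddCommGroup G] [NormedSpace ℝ G] {n : WithTop ℕ∞} {c : G → E [⋀^ι]→L[ℝ] F}
    {L : G → E' →L[ℝ] E} {x : G} (hc : ContDiffAt ℝ n c x) (hL : ContDiffAt ℝ n L x) :
    ContDiffAt ℝ n (fun y => (c y).compContinuousLinearMap (L y)) x := by
  classical
  have hc' : ContDiffAt ℝ n (fun y => (c y).toContinuousMultilinearMap) x :=
    (ContinuousAlternatingMap.toContinuousMultilinearMapCLM (𝕜 := ℝ) (E := E) (F := F)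
      (ι := ι) ℝ).contDiff.contDiffAt.comp x hc
  have hcomp : ContDiffAt ℝ n
      (fun y => (c y).toContinuousMultilinearMap.compContinuousLinearMap fun _ : ι => L y) x :=
    ContinuousMultilinearMap.cpolynomialAt_uncurry_compContinuousLinearMap.contDiffAt.comp
      (f := fun y => (fun _ : ι => L y, (c y).toContinuousMultilinearMap)) x
      ((contDiffAt_pi.2 fun _ => hL).prodMk hc')
  exact (antisymmetrization.contDiff.contDiffAt.comp x hcomp).congr_of_eventuallyEq
    (.of_forall fun y => (antisymmetrization_toContinuousMultilinearMap _).symm)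

end Alternatization

section LineAverage

variable {E : Type*} [NormedAddCommGroup E] [NormedSpace ℝ E]
  {F : Type*} [NormedAddCommGroup F] [NormedSpace ℝ F]

/-- The weighted average `x ↦ ∫₀¹ φ(q) G(x + q v) dq` of `G` in the direction `v`. For `φ = 1` it
averages a periodic form along a circle, and for `φ(q) = 1 - q` it provides the chain homotopy
between this average and the identity. -/
def lineAverage (φ : ℝ → ℝ) (v : E) (G : E → F) (x : E) : F :=
  ∫ q in (0 : ℝ)..1, φ q • G (x + q • v)

lemma hasFDerivAt_lineAverage [CompleteSpace F] [FiniteDimensional ℝ E] {φ : ℝ → ℝ}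
    (hφ : Continuous φ) (v : E) {G : E → F} (hG : ContDiff ℝ 1 G) (x : E) :
    HasFDerivAt (lineAverage φ v G) (lineAverage φ v (fderiv ℝ G) x) x := by
  have := hG.continuous
  have := hG.continuous_fderiv one_ne_zero
  have hcont : Continuous fun p : E × ℝ => φ p.2 • fderiv ℝ G (p.1 + p.2 • v) := by fun_prop
  have : ProperSpace E := FiniteDimensional.proper ℝ E
  obtain ⟨C, hC⟩ := ((isCompact_closedBall x 1).prod (isCompact_Icc (a := (0 : ℝ)) (b := 1))
    ).exists_bound_of_continuousOn hcont.continuousOn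
  refine intervalIntegral.hasFDerivAt_integral_of_dominated_of_fderiv_le (bound := fun _ => C)
    (F := fun y q => φ q • G (y + q • v)) (F' := fun y q => φ q • fderiv ℝ G (y + q • v))
    (Metric.closedBall_mem_nhds x zero_lt_one)
    (.of_forall fun y => Continuous.aestronglyMeasurable (by fun_prop))
    (Continuous.intervalIntegrable (by fun_prop) _ _)
    (Continuous.aestronglyMeasurable (by fun_prop))
    (.of_forall fun q hq y hy => ?_) intervalIntegrable_const
    (.of_forall fun q _ y _ => ?_)
  · rw [Set.uIoc_of_le zero_le_one] at hq
    exact hC (y, q) ⟨hy, hq.1.le, hq.2⟩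
  · exact ((hG.differentiable one_ne_zero _).hasFDerivAt.comp y
      ((hasFDerivAt_id y).add_const _)).const_smul (φ q)

lemma map_lineAverage {F' : Type*} [NormedAddCommGroup F'] [NormedSpace ℝ F'] [CompleteSpace F]
    [CompleteSpace F'] (A : F →L[ℝ] F') {φ : ℝ → ℝ} (hφ : Continuous φ) (v : E) {G : E → F}
    (hG : Continuous G) (x : E) :
    A (lineAverage φ v G x) = lineAverage φ v (fun y => A (G y)) x := by
  have hint : IntervalIntegrable (fun q : ℝ => φ q • G (x + q • v)) MeasureTheory.volume 0 1 :=
    Continuous.intervalIntegrable (by fun_prop) _ _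
  simp only [lineAverage, ← A.intervalIntegral_comp_comm hint, map_smul]

lemma map_fderiv_lineAverage {F' : Type*} [NormedAddCommGroup F'] [NormedSpace ℝ F']
    [CompleteSpace F] [CompleteSpace F'] [FiniteDimensional ℝ E] (A : (E →L[ℝ] F) →L[ℝ] F')
    {φ : ℝ → ℝ} (hφ : Continuous φ) (v : E) {G : E → F} (hG : ContDiff ℝ 1 G) (x : E) :
    A (fderiv ℝ (lineAverage φ v G) x) = lineAverage φ v (fun y => A (fderiv ℝ G y)) x := by
  rw [(hasFDerivAt_lineAverage hφ v hG x).fderiv]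
  exact map_lineAverage A hφ v (hG.continuous_fderiv one_ne_zero) x

lemma contDiff_lineAverage_nat [FiniteDimensional ℝ E] [CompleteSpace F] {φ : ℝ → ℝ}
    (hφ : Continuous φ) (v : E) (n : ℕ) {G : E → F} (hG : ContDiff ℝ n G) :
    ContDiff ℝ n (lineAverage φ v G) := by
  induction n generalizing G with
  | zero =>
    have := hG.continuous
    exact contDiff_zero.2 (intervalIntegral.continuous_parametric_intervalIntegral_of_continuous'
      (f := fun x q => φ q • G (x + q • v)) (by fun_prop) _ _)
  | succ n ih =>
    have hG₁ : ContDiff ℝ 1 G := hG.of_le (by simp)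
    push_cast at hG ⊢
    refine contDiff_succ_iff_fderiv_apply.2
      ⟨fun x => (hasFDerivAt_lineAverage hφ v hG₁ x).differentiableAt, by simp, fun y => ?_⟩
    have h := map_fderiv_lineAverage (ContinuousLinearMap.apply ℝ F y) hφ v hG₁
    simp only [ContinuousLinearMap.apply_apply] at h
    simp only [h]
    exact ih ((hG.fderiv_right le_rfl).clm_apply contDiff_const)

lemma contDiff_lineAverage [FiniteDimensional ℝ E] [CompleteSpace F] {φ : ℝ → ℝ}
    (hφ : Continuous φ) (v : E) {n : ℕ∞} {G : E → F} (hG : ContDiff ℝ n G) :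
    ContDiff ℝ n (lineAverage φ v G) :=
  contDiff_iff_forall_nat_le.2 fun m hm =>
    contDiff_lineAverage_nat hφ v m (hG.of_le (by exact_mod_cast hm))

lemma lineAverage_add_eq {φ : ℝ → ℝ} {v u : E} {G : E → F} (h : ∀ x, G (x + u) = G x) (x : E) :
    lineAverage φ v G (x + u) = lineAverage φ v G x := by
  simp only [lineAverage, add_right_comm x u, h]

lemma lineAverage_one_add_smul {v : E} {G : E → F} (h : ∀ x, G (x + v) = G x) (x : E) (r : ℝ) :
    lineAverage 1 v G (x + r • v) = lineAverage 1 v G x := by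
  have hper : Function.Periodic (fun q : ℝ => G (x + q • v)) 1 := fun q => by
    simp only [add_smul, one_smul, ← add_assoc, h]
  have hshift := hper.intervalIntegral_add_eq r 0
  rw [zero_add, add_comm r 1] at hshift
  have hsub := intervalIntegral.integral_comp_add_right (a := 0) (b := 1)
    (fun q : ℝ => G (x + q • v)) r
  rw [zero_add] at hsub
  simp only [lineAverage, Pi.one_apply, one_smul, ← hshift, ← hsub, add_smul, add_assoc,
    add_comm (r • v)]

lemma lineAverage_one_sub_fderiv [CompleteSpace F] (v : E) {G : E → F} (hG : ContDiff ℝ 1 G)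
    (x : E) :
    lineAverage (fun q => 1 - q) v (fun y => fderiv ℝ G y v) x = lineAverage 1 v G x - G x := by
  have := hG.continuous
  have := hG.continuous_fderiv one_ne_zero
  have hline (q : ℝ) : HasDerivAt (fun q : ℝ => G (x + q • v)) (fderiv ℝ G (x + q • v) v) q :=
    (hG.differentiable one_ne_zero _).hasFDerivAt.comp_hasDerivAt q
      (by simpa using ((hasDerivAt_id q).smul_const v).const_add x)
  have hprod (q : ℝ) : HasDerivAt (fun q : ℝ => (1 - q) • G (x + q • v))
      ((1 - q) • fderiv ℝ G (x + q • v) v - G (x + q • v)) q := by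
    simpa [← sub_eq_add_neg] using ((hasDerivAt_id q).const_sub 1).fun_smul (hline q)
  have hint₁ : IntervalIntegrable (fun q : ℝ => (1 - q) • fderiv ℝ G (x + q • v) v)
    MeasureTheory.volume 0 1 := Continuous.intervalIntegrable (by fun_prop) _ _
  have hint₀ : IntervalIntegrable (fun q : ℝ => G (x + q • v))
    MeasureTheory.volume 0 1 := Continuous.intervalIntegrable (by fun_prop) _ _
  have hftc := intervalIntegral.integral_eq_sub_of_hasDerivAt (fun q _ => hprod q)
    (hint₁.sub hint₀)
  rw [intervalIntegral.integral_sub hint₁ hint₀, sub_eq_iff_eq_add'] at hftc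
  simpa [lineAverage, sub_eq_add_neg] using hftc

end LineAverage

section ExteriorCalculus

variable {E : Type*} [NormedAddCommGroup E] [NormedSpace ℝ E]
  {F : Type*} [NormedAddCommGroup F] [NormedSpace ℝ F] {k : ℕ}

lemma contDiff_extDeriv {n : WithTop ℕ∞} {τ : E → E [⋀^Fin k]→L[ℝ] F}
    (h : ContDiff ℝ (n + 1) τ) : ContDiff ℝ n (extDeriv τ) := by
  have hfderiv : ContDiff ℝ n (fderiv ℝ τ) := h.fderiv_right le_rfl
  exact (ContinuousAlternatingMap.alternatizeUncurryFinCLM (n := k) ℝ E F).contDiff.comp hfderiv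

lemma extDeriv_lineAverage [FiniteDimensional ℝ E] [CompleteSpace F] {φ : ℝ → ℝ}
    (hφ : Continuous φ) (v : E) {τ : E → E [⋀^Fin k]→L[ℝ] F} (hτ : ContDiff ℝ 1 τ) :
    extDeriv (lineAverage φ v τ) = lineAverage φ v (extDeriv τ) :=
  funext (map_fderiv_lineAverage
    (ContinuousAlternatingMap.alternatizeUncurryFinCLM ℝ E F) hφ v hτ)

/-- The interior product `ι_v` of alternating forms, `(ι_v c)(w₁, …, w_k) = c(v, w₁, …, w_k)`. -/
def interiorProduct (v : E) : E [⋀^Fin (k + 1)]→L[ℝ] F →L[ℝ] E [⋀^Fin k]→L[ℝ] F :=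
  ContinuousLinearMap.apply ℝ _ v ∘L
    ContinuousAlternatingMap.curryLeftLI.toContinuousLinearMap

lemma interiorProduct_alternatizeUncurryFin (v : E) (f : E →L[ℝ] E [⋀^Fin (k + 1)]→L[ℝ] F) :
    interiorProduct v (ContinuousAlternatingMap.alternatizeUncurryFin f) =
      f v - ContinuousAlternatingMap.alternatizeUncurryFin (interiorProduct v ∘L f) := by
  ext w
  have hcons (i : Fin (k + 1)) :
      i.succ.removeNth (Matrix.vecCons v w) = Matrix.vecCons v (i.removeNth w) := by
    funext j
    refine Fin.cases ?_ (fun j => ?_) j <;> simp [Fin.removeNth]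
  simp [interiorProduct, ContinuousAlternatingMap.alternatizeUncurryFin_apply, Fin.sum_univ_succ,
    pow_succ, hcons, sub_eq_add_neg]

/-- **Cartan's formula** for a constant vector field. -/
lemma extDeriv_interiorProduct (v : E) {τ : E → E [⋀^Fin (k + 1)]→L[ℝ] F} {x : E}
    (h : DifferentiableAt ℝ τ x) :
    extDeriv (fun y => interiorProduct v (τ y)) x =
      fderiv ℝ τ x v - interiorProduct v (extDeriv τ x) := by
  have hfderiv :
      fderiv ℝ (fun y => interiorProduct v (τ y)) x = interiorProduct v ∘L fderiv ℝ τ x :=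
    ((interiorProduct (F := F) (k := k) v).hasFDerivAt.comp x h.hasFDerivAt).fderiv
  rw [extDeriv, extDeriv, interiorProduct_alternatizeUncurryFin, hfderiv, sub_sub_cancel]

lemma extDeriv_lineAverage_interiorProduct [FiniteDimensional ℝ E] [CompleteSpace F] (v : E)
    {τ : E → E [⋀^Fin (k + 1)]→L[ℝ] F} (hτ : ContDiff ℝ 1 τ) (hclosed : extDeriv τ = 0) :
    extDeriv (lineAverage (fun q => 1 - q) v fun y => interiorProduct v (τ y)) =
      lineAverage 1 v τ - τ := by
  have hcartan : extDeriv (fun y => interiorProduct v (τ y)) = fun y => fderiv ℝ τ y v := by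
    funext y
    rw [extDeriv_interiorProduct v (hτ.differentiable one_ne_zero y), hclosed, Pi.zero_apply,
      map_zero, sub_zero]
  rw [extDeriv_lineAverage (by fun_prop) v (by fun_prop), hcartan]
  exact funext (lineAverage_one_sub_fderiv v hτ)

lemma extDeriv_smul_fun {f : E → ℝ} {τ : E → E [⋀^Fin k]→L[ℝ] ℝ} {x : E}
    (hf : DifferentiableAt ℝ f x) (h : DifferentiableAt ℝ τ x) :
    extDeriv (fun y => f y • τ y) x = f x • extDeriv τ x +
      wedgeAt (ContinuousAlternatingMap.ofSubsingleton ℝ E ℝ (0 : Fin 1) (fderiv ℝ f x)) (τ x) := by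
  rw [extDeriv, fderiv_fun_smul hf h, ContinuousAlternatingMap.alternatizeUncurryFin_add,
    ContinuousAlternatingMap.alternatizeUncurryFin_smul, wedgeAt, Equiv.symm_apply_apply]
  rfl

end ExteriorCalculus

end MorseNovikov

/-! ### Periodic forms -/

namespace MorseNovikov

lemma two_le_infty : minSmoothness ℝ 2 ≤ (∞ : WithTop ℕ∞) := by
  rw [minSmoothness_of_isRCLikeNormedField]
  exact WithTop.coe_le_coe.2 (le_top : (2 : ℕ∞) ≤ ⊤)

section Invariance

variable {E : Type*} [NormedAddCommGroup E] [NormedSpace ℝ E]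
  {F : Type*} [NormedAddCommGroup F] [NormedSpace ℝ F] {k : ℕ}

lemma fderiv_apply_eq_zero_of_invariant {G : E → F} {x v : E} (hG : DifferentiableAt ℝ G x)
    (h : ∀ r : ℝ, G (x + r • v) = G x) : fderiv ℝ G x v = 0 := by
  rw [← hG.lineDeriv_eq_fderiv, lineDeriv, funext h, deriv_const]

lemma extDeriv_add_right {τ : E → E [⋀^Fin k]→L[ℝ] F} {u : E} (h : ∀ x, τ (x + u) = τ x)
    (x : E) : extDeriv τ (x + u) = extDeriv τ x := by
  rw [extDeriv, extDeriv, ← fderiv_comp_add_right, funext h]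

lemma extDeriv_sub {τ τ' : E → E [⋀^Fin k]→L[ℝ] F} (h : Differentiable ℝ τ)
    (h' : Differentiable ℝ τ') : extDeriv (τ - τ') = extDeriv τ - extDeriv τ' := by
  funext x
  rw [Pi.sub_apply, extDeriv, fderiv_sub (h x) (h' x)]
  exact map_sub (ContinuousAlternatingMap.alternatizeUncurryFinCLM ℝ E F) _ _

lemma extDeriv_const (c : E [⋀^Fin k]→L[ℝ] F) : extDeriv (fun _ : E => c) = 0 := by
  funext x
  rw [extDeriv, fderiv_const_apply]
  exact map_zero (ContinuousAlternatingMap.alternatizeUncurryFinCLM ℝ E F)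

variable {ℓ : E →L[ℝ] ℝ} {v : E}

lemma interiorProduct_alternatizeUncurryFin_smulRight (hv : ℓ v = 1)
    (c : E [⋀^Fin (k + 1)]→L[ℝ] F) :
    interiorProduct v (ContinuousAlternatingMap.alternatizeUncurryFin
      (ℓ.smulRight (interiorProduct v c))) = interiorProduct v c := by
  cases k with
  | zero =>
    ext w
    simp [interiorProduct, ContinuousAlternatingMap.alternatizeUncurryFin_apply, hv]
  | succ k =>
    have hzero : interiorProduct v ∘L ℓ.smulRight (interiorProduct v c) = 0 := by
      ext u w
      simp [interiorProduct]
    rw [interiorProduct_alternatizeUncurryFin, hzero, ContinuousLinearMap.smulRight_apply, hv,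
      one_smul, sub_eq_self]
    exact map_zero (ContinuousAlternatingMap.alternatizeUncurryFinCLM ℝ E F)

lemma compContinuousLinearMap_eq_of_interiorProduct_eq_zero {c : E [⋀^Fin (k + 1)]→L[ℝ] F}
    (hc : interiorProduct v c = 0) :
    c.compContinuousLinearMap (ContinuousLinearMap.id ℝ E - ℓ.smulRight v) = c := by
  have hupdate (i : Fin (k + 1)) (w : Fin (k + 1) → E) : c (Function.update w i v) = 0 := by
    have hcons : c (Matrix.vecCons v (i.removeNth w)) = 0 :=
      congrArg (fun f => f (i.removeNth w)) hc
    rw [← Fin.insertNth_removeNth, ContinuousAlternatingMap.map_insertNth, hcons, smul_zero]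
  have hpiecewise (w : Fin (k + 1) → E) (s : Finset (Fin (k + 1))) :
      c (s.piecewise (fun i => w i - ℓ (w i) • v) w) = c w := by
    induction s using Finset.induction_on with
    | empty => simp
    | insert j s hj ih =>
      rw [Finset.piecewise_insert, ContinuousAlternatingMap.map_update_sub,
        ContinuousAlternatingMap.map_update_smul, hupdate, smul_zero, sub_zero, ← ih,
        Function.update_eq_self_iff.2 (Finset.piecewise_eq_of_notMem _ _ _ hj).symm]
  ext w
  have huniv := hpiecewise w Finset.univ
  rwa [Finset.piecewise_univ] at huniv

/-- Integrating `ι_v τ` along `v` makes the `v`-component of `τ` exact. -/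
lemma exists_interiorProduct_extDeriv_eq [CompleteSpace F] (hv : ℓ v = 1)
    {τ : E → E [⋀^Fin (k + 1)]→L[ℝ] F} (h : ContDiff ℝ ∞ τ)
    (hinv : ∀ u, ℓ u = 0 → ∀ x, τ (x + u) = τ x) :
    ∃ ρ : E → E [⋀^Fin k]→L[ℝ] F, ContDiff ℝ ∞ ρ ∧ (∀ u, ℓ u = 0 → ∀ x, ρ (x + u) = ρ x) ∧
      ∀ x, interiorProduct v (extDeriv ρ x) = interiorProduct v (τ x) := by
  let g : ℝ → E [⋀^Fin k]→L[ℝ] F := fun q => interiorProduct v (τ (q • v))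
  let P : ℝ → E [⋀^Fin k]→L[ℝ] F := fun y => ∫ q in (0 : ℝ)..y, g q
  have hg : ContDiff ℝ ∞ g := by fun_prop
  have hg_height (x : E) : g (ℓ x) = interiorProduct v (τ x) := by
    have h := hinv (x - ℓ x • v) (by simp [hv]) (ℓ x • v)
    rw [add_sub_cancel] at h
    simp only [g, h]
  have hP (y : ℝ) : HasDerivAt P (g y) y := intervalIntegral.integral_hasDerivAt_right
    (hg.continuous.intervalIntegrable _ _)
    hg.continuous.aestronglyMeasurable.stronglyMeasurableAtFilter hg.continuous.continuousAt
  have hP_smooth : ContDiff ℝ ∞ P := by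
    rw [contDiff_infty_iff_deriv, funext fun y => (hP y).deriv]
    exact ⟨fun y => (hP y).differentiableAt, hg⟩
  refine ⟨P ∘ ℓ, hP_smooth.comp ℓ.contDiff, fun u hu x => by simp [hu], fun x => ?_⟩
  have hfderiv : fderiv ℝ (P ∘ ℓ) x = ℓ.smulRight (g (ℓ x)) := by
    rw [((hP (ℓ x)).hasFDerivAt.comp x ℓ.hasFDerivAt).fderiv]
    ext
    simp
  rw [extDeriv, hfderiv, hg_height, interiorProduct_alternatizeUncurryFin_smulRight hv]

lemma eq_of_extDeriv_eq_zero_of_interiorProduct_eq_zero (hv : ℓ v = 1)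
    {τ : E → E [⋀^Fin (k + 1)]→L[ℝ] F} (h : Differentiable ℝ τ)
    (hinv : ∀ u, ℓ u = 0 → ∀ x, τ (x + u) = τ x) (hclosed : extDeriv τ = 0)
    (hι : ∀ x, interiorProduct v (τ x) = 0) (x y : E) : τ x = τ y := by
  have hvertical (x : E) : fderiv ℝ τ x v = 0 := by
    have hcartan := extDeriv_interiorProduct v (h x)
    rw [funext hι, hclosed, extDeriv_const, Pi.zero_apply, Pi.zero_apply, map_zero,
      sub_zero] at hcartan
    exact hcartan.symm
  refine is_const_of_fderiv_eq_zero h (fun x => ContinuousLinearMap.ext fun w => ?_) x y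
  have hhorizontal : fderiv ℝ τ x (w - ℓ w • v) = 0 :=
    fderiv_apply_eq_zero_of_invariant (h x) fun r => hinv _ (by simp [hv]) x
  rwa [map_sub, map_smul, hvertical, smul_zero, sub_zero] at hhorizontal

lemma exists_eq_const_add_of_invariant [CompleteSpace F] (hv : ℓ v = 1)
    {τ : E → E [⋀^Fin (k + 1)]→L[ℝ] F} (h : ContDiff ℝ ∞ τ)
    (hinv : ∀ u, ℓ u = 0 → ∀ x, τ (x + u) = τ x) (hclosed : extDeriv τ = 0) :
    ∃ c : E [⋀^Fin (k + 1)]→L[ℝ] F, interiorProduct v c = 0 ∧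
      ∃ ρ : E → E [⋀^Fin k]→L[ℝ] F, ContDiff ℝ ∞ ρ ∧ (∀ u, ℓ u = 0 → ∀ x, ρ (x + u) = ρ x) ∧
        τ = (fun _ => c) + extDeriv ρ := by
  obtain ⟨ρ, hρ, hρ_inv, hρ_vertical⟩ := exists_interiorProduct_extDeriv_eq hv h hinv
  have hρ' : ContDiff ℝ ∞ (extDeriv ρ) := contDiff_extDeriv hρ
  have hdiff : Differentiable ℝ (τ - extDeriv ρ) := (h.sub hρ').differentiable (by simp)
  have hdiff_inv (u : E) (hu : ℓ u = 0) (x : E) :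
      (τ - extDeriv ρ) (x + u) = (τ - extDeriv ρ) x := by
    rw [Pi.sub_apply, Pi.sub_apply, hinv u hu, extDeriv_add_right (hρ_inv u hu)]
  have hdiff_closed : extDeriv (τ - extDeriv ρ) = 0 := by
    rw [extDeriv_sub (h.differentiable (by simp)) (hρ'.differentiable (by simp)), hclosed,
      extDeriv_extDeriv hρ two_le_infty, sub_zero]
  have hdiff_vertical (x : E) : interiorProduct v ((τ - extDeriv ρ) x) = 0 := by
    rw [Pi.sub_apply, map_sub, hρ_vertical, sub_self]
  have hconst := eq_of_extDeriv_eq_zero_of_interiorProduct_eq_zero hv hdiff hdiff_inv hdiff_closed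
    hdiff_vertical
  refine ⟨(τ - extDeriv ρ) 0, hdiff_vertical 0, ρ, hρ, hρ_inv, funext fun x => ?_⟩
  rw [Pi.add_apply, hconst 0 x, Pi.sub_apply, sub_add_cancel]

end Invariance

end MorseNovikov

namespace Inoue

open MorseNovikov

/-- Differential forms on the universal cover, in coordinates `(z, x + i y)` on `ℂ × ℂ` such that
`w = x + i αʸ`. -/
abbrev CoverForm (k : ℕ) : Type := ℂ × ℂ → (ℂ × ℂ) [⋀^Fin k]→L[ℝ] ℝ

/-- The vector field `∂/∂y`. -/
def vertical : ℂ × ℂ := (0, Complex.I)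

/-- The coordinate `y`, whose differential is the linear form `dy`. -/
def height : ℂ × ℂ →L[ℝ] ℝ := Complex.imCLM.comp (ContinuousLinearMap.snd ℝ ℂ ℂ)

lemma height_apply (v : ℂ × ℂ) : height v = v.2.im := rfl

lemma height_vertical : height vertical = 1 := by simp [height_apply, vertical]

/-- The projection onto `ℂ × ℝ` along `∂/∂y`. -/
def horizontalProj : ℂ × ℂ →L[ℝ] ℂ × ℂ :=
  ContinuousLinearMap.id ℝ (ℂ × ℂ) - height.smulRight vertical

lemma height_horizontalProj (v : ℂ × ℂ) : height (horizontalProj v) = 0 := by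
  simp [horizontalProj, height_vertical]

variable (k : ℕ) in
/-- Constant forms that do not involve `dy`, that is, invariant forms on the torus fibre. -/
def horizontalForms : Submodule ℝ ((ℂ × ℂ) [⋀^Fin k]→L[ℝ] ℝ) :=
  LinearMap.eqLocus
    (ContinuousAlternatingMap.compContinuousLinearMapCLM horizontalProj).toLinearMap LinearMap.id

variable {k : ℕ}

lemma apply_horizontalProj {c : (ℂ × ℂ) [⋀^Fin k]→L[ℝ] ℝ} (hc : c ∈ horizontalForms k)
    (v : Fin k → ℂ × ℂ) : c (fun i => horizontalProj (v i)) = c v :=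
  congrArg (fun f => f v) (show c.compContinuousLinearMap horizontalProj = c from hc)

lemma eq_zero_of_mem_horizontalForms {c : (ℂ × ℂ) [⋀^Fin k]→L[ℝ] ℝ} (hc : c ∈ horizontalForms k)
    (h : ∀ v : Fin k → ℂ × ℂ, (∀ i, height (v i) = 0) → c v = 0) : c = 0 := by
  ext v
  rw [← apply_horizontalProj hc]
  exact h _ fun i => height_horizontalProj _

lemma mem_horizontalForms_of_interiorProduct_eq_zero {c : (ℂ × ℂ) [⋀^Fin (k + 1)]→L[ℝ] ℝ}
    (hc : interiorProduct vertical c = 0) : c ∈ horizontalForms (k + 1) :=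
  compContinuousLinearMap_eq_of_interiorProduct_eq_zero hc

namespace InoueData

variable (D : InoueData)

/-- The linear map spanned by the translation lattice, from `ℝ³` onto `ℂ × ℝ ⊆ ℂ × ℂ`; lattice
vectors are the images of the integral points. -/
def lattice : (Fin 3 → ℝ) →ₗ[ℝ] ℂ × ℂ :=
  (LinearMap.prodMap LinearMap.id Complex.ofRealCLM.toLinearMap).comp D.period

lemma lattice_apply (x : Fin 3 → ℝ) :
    D.lattice x = (∑ i, (x i : ℂ) * D.b i, ((∑ i, x i * D.a i : ℝ) : ℂ)) := by
  rw [lattice, LinearMap.comp_apply, period_apply]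
  rfl

lemma height_lattice (x : Fin 3 → ℝ) : height (D.lattice x) = 0 := by
  rw [lattice_apply, height_apply, Complex.ofReal_im]

lemma exists_lattice_eq {v : ℂ × ℂ} (hv : height v = 0) : ∃ x, D.lattice x = v := by
  have hsurj : Function.Surjective D.period := by
    rw [← LinearMap.injective_iff_surjective_of_finrank_eq_finrank (by simp)]
    exact LinearMap.ker_eq_bot.1 D.ker_period
  obtain ⟨x, hx⟩ := hsurj (v.1, v.2.re)
  rw [height_apply] at hv
  refine ⟨x, ?_⟩
  rw [lattice, LinearMap.comp_apply, hx]
  refine Prod.ext rfl (Complex.ext ?_ ?_) <;> simp [hv]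

/-- Smooth forms on the universal cover that are periodic with respect to the translations
in `G_A`. -/
def periodicForms (k : ℕ) : Submodule ℝ (CoverForm k) where
  carrier := {τ | ContDiff ℝ ∞ τ ∧ ∀ (m : Fin 3 → ℤ) (x : ℂ × ℂ),
    τ (x + D.lattice fun i => (m i : ℝ)) = τ x}
  zero_mem' := ⟨contDiff_const, fun _ _ => rfl⟩
  add_mem' := fun {_ _} h₁ h₂ => ⟨h₁.1.add h₂.1, fun m x => by
    rw [Pi.add_apply, Pi.add_apply, h₁.2, h₂.2]⟩
  smul_mem' := fun c _ h => ⟨h.1.const_smul c, fun m x => by rw [Pi.smul_apply, Pi.smul_apply, h.2]⟩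

variable {D} {k : ℕ} {τ : CoverForm k}

lemma const_mem_periodicForms (c : (ℂ × ℂ) [⋀^Fin k]→L[ℝ] ℝ) : (fun _ => c) ∈ D.periodicForms k :=
  ⟨contDiff_const, fun _ _ => rfl⟩

lemma differentiable_of_mem_periodicForms (h : τ ∈ D.periodicForms k) : Differentiable ℝ τ :=
  h.1.differentiable (by simp)

lemma contDiff_one_of_mem_periodicForms (h : τ ∈ D.periodicForms k) : ContDiff ℝ 1 τ :=
  h.1.of_le (by simp)

lemma extDeriv_mem_periodicForms (h : τ ∈ D.periodicForms k) :
    extDeriv τ ∈ D.periodicForms (k + 1) :=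
  ⟨contDiff_extDeriv h.1, fun m => extDeriv_add_right (h.2 m)⟩

lemma extDeriv_add_of_mem_periodicForms {τ' : CoverForm k} (h : τ ∈ D.periodicForms k)
    (h' : τ' ∈ D.periodicForms k) : extDeriv (τ + τ') = extDeriv τ + extDeriv τ' :=
  funext fun x => extDeriv_add (differentiable_of_mem_periodicForms h x)
    (differentiable_of_mem_periodicForms h' x)

lemma extDeriv_sub_of_mem_periodicForms {τ' : CoverForm k} (h : τ ∈ D.periodicForms k)
    (h' : τ' ∈ D.periodicForms k) : extDeriv (τ - τ') = extDeriv τ - extDeriv τ' :=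
  extDeriv_sub (differentiable_of_mem_periodicForms h) (differentiable_of_mem_periodicForms h')

lemma lineAverage_mem_periodicForms {φ : ℝ → ℝ} (hφ : Continuous φ) (v : ℂ × ℂ)
    (h : τ ∈ D.periodicForms k) : lineAverage φ v τ ∈ D.periodicForms k :=
  ⟨contDiff_lineAverage hφ v h.1, fun m => lineAverage_add_eq (h.2 m)⟩

lemma interiorProduct_mem_periodicForms (v : ℂ × ℂ) {τ : CoverForm (k + 1)}
    (h : τ ∈ D.periodicForms (k + 1)) :
    (fun x => interiorProduct v (τ x)) ∈ D.periodicForms k :=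
  ⟨(interiorProduct (k := k) (F := ℝ) v).contDiff.comp h.1, fun m x => by simp only [h.2]⟩

lemma exists_lineAverage_one_eq_add (v : ℂ × ℂ) {τ : CoverForm (k + 1)}
    (h : τ ∈ D.periodicForms (k + 1)) (hclosed : extDeriv τ = 0) :
    ∃ ρ ∈ D.periodicForms k, lineAverage 1 v τ = τ + extDeriv ρ :=
  ⟨_, lineAverage_mem_periodicForms (φ := fun q => 1 - q) (by fun_prop) v
      (interiorProduct_mem_periodicForms v h), by
    rw [extDeriv_lineAverage_interiorProduct v (contDiff_one_of_mem_periodicForms h) hclosed,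
      add_sub_cancel]⟩

variable (D) in
/-- The `i`-th generator of the translation lattice. -/
def generator (i : Fin 3) : ℂ × ℂ := D.lattice fun j => ((Pi.single i 1 : Fin 3 → ℤ) j : ℝ)

lemma lattice_eq_sum (x : Fin 3 → ℝ) : D.lattice x = ∑ i, x i • D.generator i := by
  simp only [generator, ← map_smul, ← map_sum]
  congr 1
  funext j
  simp [Pi.single_apply]

variable (D) in
/-- The average of a form over the torus fibre. -/
def torusAverage (τ : CoverForm k) : CoverForm k :=
  lineAverage 1 (D.generator 2) (lineAverage 1 (D.generator 1) (lineAverage 1 (D.generator 0) τ))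

lemma torusAverage_mem_periodicForms (h : τ ∈ D.periodicForms k) :
    D.torusAverage τ ∈ D.periodicForms k :=
  lineAverage_mem_periodicForms continuous_one _ (lineAverage_mem_periodicForms continuous_one _
    (lineAverage_mem_periodicForms continuous_one _ h))

lemma extDeriv_lineAverage_one (v : ℂ × ℂ) (h : τ ∈ D.periodicForms k) :
    extDeriv (lineAverage 1 v τ) = lineAverage 1 v (extDeriv τ) :=
  extDeriv_lineAverage continuous_one v (contDiff_one_of_mem_periodicForms h)

lemma extDeriv_torusAverage (h : τ ∈ D.periodicForms k) :
    extDeriv (D.torusAverage τ) = D.torusAverage (extDeriv τ) := by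
  have h₁ := lineAverage_mem_periodicForms continuous_one (D.generator 0) h
  have h₂ := lineAverage_mem_periodicForms continuous_one (D.generator 1) h₁
  rw [torusAverage, extDeriv_lineAverage_one _ h₂, extDeriv_lineAverage_one _ h₁,
    extDeriv_lineAverage_one _ h, torusAverage]

lemma lineAverage_one_const (v : ℂ × ℂ) (c : (ℂ × ℂ) [⋀^Fin k]→L[ℝ] ℝ) :
    lineAverage 1 v (fun _ : ℂ × ℂ => c) = fun _ => c := by
  funext x
  simp [lineAverage]

lemma torusAverage_const (c : (ℂ × ℂ) [⋀^Fin k]→L[ℝ] ℝ) :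
    D.torusAverage (fun _ => c) = fun _ => c := by
  simp only [torusAverage, lineAverage_one_const]

lemma torusAverage_add (h : τ ∈ D.periodicForms k) {v : ℂ × ℂ} (hv : height v = 0)
    (x : ℂ × ℂ) : D.torusAverage τ (x + v) = D.torusAverage τ x := by
  have h₁ := lineAverage_mem_periodicForms continuous_one (D.generator 0) h
  have h₂ := lineAverage_mem_periodicForms continuous_one (D.generator 1) h₁
  have hgen₀ (r : ℝ) (x) : D.torusAverage τ (x + r • D.generator 0) = D.torusAverage τ x :=
    lineAverage_add_eq (lineAverage_add_eq fun x => lineAverage_one_add_smul (h.2 _) x r) x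
  have hgen₁ (r : ℝ) (x) : D.torusAverage τ (x + r • D.generator 1) = D.torusAverage τ x :=
    lineAverage_add_eq (fun x => lineAverage_one_add_smul (h₁.2 _) x r) x
  have hgen₂ (r : ℝ) (x) : D.torusAverage τ (x + r • D.generator 2) = D.torusAverage τ x :=
    lineAverage_one_add_smul (h₂.2 _) x r
  obtain ⟨y, rfl⟩ := D.exists_lattice_eq hv
  rw [lattice_eq_sum, Fin.sum_univ_three, ← add_assoc, ← add_assoc, hgen₂, hgen₁, hgen₀]

lemma exists_eq_torusAverage_add {τ : CoverForm (k + 1)} (h : τ ∈ D.periodicForms (k + 1))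
    (hclosed : extDeriv τ = 0) :
    ∃ ρ ∈ D.periodicForms k, τ = D.torusAverage τ + extDeriv ρ := by
  have h₁ := lineAverage_mem_periodicForms continuous_one (D.generator 0) h
  have h₂ := lineAverage_mem_periodicForms continuous_one (D.generator 1) h₁
  have hclosed₁ : extDeriv (lineAverage 1 (D.generator 0) τ) = 0 := by
    rw [extDeriv_lineAverage_one _ h, hclosed]
    exact lineAverage_one_const _ 0
  have hclosed₂ :
      extDeriv (lineAverage 1 (D.generator 1) (lineAverage 1 (D.generator 0) τ)) = 0 := by
    rw [extDeriv_lineAverage_one _ h₁, hclosed₁]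
    exact lineAverage_one_const _ 0
  obtain ⟨ρ₁, hρ₁, e₁⟩ := exists_lineAverage_one_eq_add (D.generator 0) h hclosed
  obtain ⟨ρ₂, hρ₂, e₂⟩ := exists_lineAverage_one_eq_add (D.generator 1) h₁ hclosed₁
  obtain ⟨ρ₃, hρ₃, e₃⟩ := exists_lineAverage_one_eq_add (D.generator 2) h₂ hclosed₂
  have hρ₁₂ := add_mem hρ₁ hρ₂
  have hρ := add_mem hρ₁₂ hρ₃
  refine ⟨0 - (ρ₁ + ρ₂ + ρ₃), sub_mem (zero_mem _) hρ, ?_⟩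
  have hzero : extDeriv (0 : CoverForm k) = 0 := extDeriv_const 0
  rw [torusAverage, e₃, e₂, e₁, extDeriv_sub_of_mem_periodicForms (zero_mem _) hρ,
    extDeriv_add_of_mem_periodicForms hρ₁₂ hρ₃, extDeriv_add_of_mem_periodicForms hρ₁ hρ₂, hzero]
  abel

lemma eq_zero_of_const_eq_extDeriv {c : (ℂ × ℂ) [⋀^Fin (k + 1)]→L[ℝ] ℝ}
    (hc : c ∈ horizontalForms (k + 1)) {ρ : CoverForm k} (hρ : ρ ∈ D.periodicForms k)
    (h : (fun _ => c) = extDeriv ρ) : c = 0 := by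
  refine eq_zero_of_mem_horizontalForms hc fun v hv => ?_
  have haverage : (fun _ => c) = extDeriv (D.torusAverage ρ) := by
    rw [extDeriv_torusAverage hρ, ← h, torusAverage_const]
  have hfderiv (i : Fin (k + 1)) : fderiv ℝ (D.torusAverage ρ) 0 (v i) = 0 :=
    fderiv_apply_eq_zero_of_invariant
      (differentiable_of_mem_periodicForms (torusAverage_mem_periodicForms hρ) 0)
      fun r => torusAverage_add hρ (by simp [hv i]) 0
  rw [show c = extDeriv (D.torusAverage ρ) 0 from congrFun haverage 0, extDeriv,
    ContinuousAlternatingMap.alternatizeUncurryFin_apply]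
  exact Finset.sum_eq_zero fun i _ => by simp [hfderiv]

lemma exists_eq_const_add {τ : CoverForm (k + 1)} (h : τ ∈ D.periodicForms (k + 1))
    (hclosed : extDeriv τ = 0) :
    ∃ c ∈ horizontalForms (k + 1), ∃ ρ ∈ D.periodicForms k, τ = (fun _ => c) + extDeriv ρ := by
  obtain ⟨ρ, hρ, hτ⟩ := exists_eq_torusAverage_add h hclosed
  have hclosed' : extDeriv (D.torusAverage τ) = 0 := by
    rw [extDeriv_torusAverage h, hclosed]
    exact torusAverage_const 0
  obtain ⟨c, hc, ρ', hρ', hinv, haverage⟩ := exists_eq_const_add_of_invariant height_vertical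
    (torusAverage_mem_periodicForms h).1 (fun _ hv => torusAverage_add h hv) hclosed'
  have hρ'_mem : ρ' ∈ D.periodicForms k := ⟨hρ', fun m => hinv _ (D.height_lattice _)⟩
  refine ⟨c, mem_horizontalForms_of_interiorProduct_eq_zero hc, ρ' + ρ, add_mem hρ'_mem hρ, ?_⟩
  rw [extDeriv_add_of_mem_periodicForms hρ'_mem hρ, ← add_assoc, ← haverage, ← hτ]

end InoueData

end Inoue

/-! ### Deck transformations in logarithmic coordinates -/

namespace Inoue

open MorseNovikov

namespace InoueData

variable (D : InoueData) {k : ℕ}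

/-- The linear part `(z, x + i y) ↦ (βⁿ z, αⁿ x + i y)` of a deck transformation. -/
def deckLinear (n : ℤ) : ℂ × ℂ →L[ℝ] ℂ × ℂ :=
  (ContinuousLinearMap.mul ℝ ℂ (D.β ^ n)).prodMap
    (D.α ^ n • Complex.ofRealCLM.comp Complex.reCLM + Complex.imCLM.smulRight Complex.I)

lemma deckLinear_fst (n : ℤ) (v : ℂ × ℂ) : (D.deckLinear n v).1 = D.β ^ n * v.1 := rfl

lemma deckLinear_re (n : ℤ) (v : ℂ × ℂ) : (D.deckLinear n v).2.re = D.α ^ n * v.2.re := by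
  simp [deckLinear, -Complex.ofReal_zpow]

lemma height_deckLinear (n : ℤ) (v : ℂ × ℂ) : height (D.deckLinear n v) = height v := by
  simp [deckLinear, height_apply, -Complex.ofReal_zpow]

lemma deckLinear_deckLinear (m n : ℤ) (v : ℂ × ℂ) :
    D.deckLinear m (D.deckLinear n v) = D.deckLinear (m + n) v := by
  refine Prod.ext ?_ (Complex.ext ?_ ?_)
  · simp only [deckLinear_fst, zpow_add₀ D.β_ne_zero, mul_assoc]
  · simp only [deckLinear_re, zpow_add₀ D.α_pos.ne', mul_assoc]
  · simp only [← height_apply, height_deckLinear]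

lemma deckLinear_zero (v : ℂ × ℂ) : D.deckLinear 0 v = v := by
  refine Prod.ext ?_ (Complex.ext ?_ ?_)
  · simp [deckLinear_fst]
  · simp [deckLinear_re]
  · simp [← height_apply, height_deckLinear]

lemma deckLinear_vertical (n : ℤ) : D.deckLinear n vertical = vertical := by
  simp [deckLinear, vertical]

lemma deckLinear_lattice (n : ℤ) (m : Fin 3 → ℤ) :
    D.deckLinear n (D.lattice fun i => (m i : ℝ)) =
      D.lattice fun i => ((m ᵥ* (D.A ^ n).1) i : ℝ) := by
  have hβ := zpow_sum D.A D.β_ne_zero D.mulVec_b n m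
  have hα := zpow_sum D.A D.α_pos.ne' D.mulVec_a n m
  refine Prod.ext ?_ (Complex.ext ?_ ?_)
  · simp only [deckLinear_fst, lattice_apply]
    push_cast at hβ ⊢
    exact hβ
  · rw [deckLinear_re]
    simp only [lattice_apply, Complex.ofReal_re]
    exact hα
  · rw [← height_apply, ← height_apply, height_deckLinear, height_lattice, height_lattice]

/-- The `n`-th power `(z, x + i y) ↦ (βⁿ z, αⁿ x + i (y + n))` of the dilation
`(z, w) ↦ (β z, α w)`, in the coordinates of `CoverForm`. -/
def deckMap (n : ℤ) (x : ℂ × ℂ) : ℂ × ℂ := D.deckLinear n x + (n : ℝ) • vertical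

lemma height_deckMap (n : ℤ) (x : ℂ × ℂ) : height (D.deckMap n x) = height x + n := by
  simp [deckMap, height_deckLinear, height_vertical]

lemma deckMap_add (n : ℤ) (x v : ℂ × ℂ) :
    D.deckMap n (x + v) = D.deckMap n x + D.deckLinear n v := by
  simp only [deckMap, map_add]
  abel

lemma deckMap_deckMap (m n : ℤ) (x : ℂ × ℂ) :
    D.deckMap m (D.deckMap n x) = D.deckMap (m + n) x := by
  rw [deckMap, deckMap, map_add, map_smul, deckLinear_vertical, deckLinear_deckLinear, deckMap]
  push_cast
  rw [add_smul, add_assoc, add_comm ((n : ℝ) • vertical)]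

lemma contDiff_deckMap (n : ℤ) : ContDiff ℝ ∞ (D.deckMap n) :=
  (D.deckLinear n).contDiff.add contDiff_const

lemma fderiv_deckMap (n : ℤ) (x : ℂ × ℂ) : fderiv ℝ (D.deckMap n) x = D.deckLinear n :=
  ((D.deckLinear n).hasFDerivAt.add_const _).fderiv

/-- The pullback by the `n`-th power of the dilation, multiplied by `αⁿ`. The factor makes it act
on `α⁻ʸ • τ` as the plain pullback acts on `τ`. -/
def twistedPullback (n : ℤ) : CoverForm k →ₗ[ℝ] CoverForm k where
  toFun τ x := D.α ^ n • (τ (D.deckMap n x)).compContinuousLinearMap (D.deckLinear n)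
  map_add' τ τ' := by
    funext x
    ext v
    exact mul_add _ _ _
  map_smul' c τ := by
    funext x
    ext v
    exact mul_left_comm _ _ _

lemma twistedPullback_apply (n : ℤ) (τ : CoverForm k) (x : ℂ × ℂ) : D.twistedPullback n τ x =
    D.α ^ n • (τ (D.deckMap n x)).compContinuousLinearMap (D.deckLinear n) := rfl

lemma twistedPullback_twistedPullback (m n : ℤ) (τ : CoverForm k) :
    D.twistedPullback m (D.twistedPullback n τ) = D.twistedPullback (m + n) τ := by
  funext x
  ext v
  simp only [twistedPullback_apply, ContinuousAlternatingMap.smul_apply, smul_eq_mul,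
    ContinuousAlternatingMap.compContinuousLinearMap_apply, deckMap_deckMap,
    zpow_add₀ D.α_pos.ne', add_comm n m, mul_assoc, Function.comp_def, deckLinear_deckLinear]

lemma twistedPullback_zero (τ : CoverForm k) : D.twistedPullback 0 τ = τ := by
  funext x
  ext v
  simp [twistedPullback_apply, deckMap, deckLinear_zero, Function.comp_def]

variable {D} {τ : CoverForm k}

lemma twistedPullback_mem_periodicForms (n : ℤ) (h : τ ∈ D.periodicForms k) :
    D.twistedPullback n τ ∈ D.periodicForms k := by
  have hsmooth :
      ContDiff ℝ ∞ fun x => (τ (D.deckMap n x)).compContinuousLinearMap (D.deckLinear n) :=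
    (ContinuousAlternatingMap.compContinuousLinearMapCLM (𝕜 := ℝ) (F := ℝ) (ι := Fin k)
      (D.deckLinear n)).contDiff.comp (h.1.comp (D.contDiff_deckMap n))
  refine ⟨hsmooth.const_smul (D.α ^ n), fun m x => ?_⟩
  rw [twistedPullback_apply, twistedPullback_apply, deckMap_add, deckLinear_lattice, h.2]

lemma extDeriv_twistedPullback (n : ℤ) (h : Differentiable ℝ τ) :
    extDeriv (D.twistedPullback n τ) = D.twistedPullback n (extDeriv τ) := by
  funext x
  have hτ : D.twistedPullback n τ = D.α ^ n • fun y =>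
      (τ (D.deckMap n y)).compContinuousLinearMap (fderiv ℝ (D.deckMap n) y) := by
    funext y
    rw [Pi.smul_apply, fderiv_deckMap, twistedPullback_apply]
  rw [hτ, extDeriv_smul, extDeriv_pullback (h _) (D.contDiff_deckMap n).contDiffAt two_le_infty,
    fderiv_deckMap, twistedPullback_apply]

lemma twistedPullback_tsum {f : ℕ → CoverForm k} (ε : ℤ) (x : ℂ × ℂ)
    (hf : Summable fun n => f n (D.deckMap ε x)) :
    D.twistedPullback ε (fun y => ∑' n, f n y) x = ∑' n, D.twistedPullback ε (f n) x :=
  ContinuousLinearMap.map_tsum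
    (D.α ^ ε • ContinuousAlternatingMap.compContinuousLinearMapCLM (F := ℝ) (ι := Fin k)
      (D.deckLinear ε)) hf

/-- The geometric series `∑ Tⁿ τ` solves `ν - T ν = τ` as soon as it is locally finite. -/
lemma exists_sub_twistedPullback_eq_of_locallyFinite (ε : ℤ) (h : τ ∈ D.periodicForms k)
    (hfin : ∀ x : ℂ × ℂ, ∃ N : ℕ, ∀ᶠ y in 𝓝 x, ∀ n ≥ N, D.twistedPullback (ε * n) τ y = 0) :
    ∃ ν ∈ D.periodicForms k, ν - D.twistedPullback ε ν = τ := by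
  have hsum (x : ℂ × ℂ) : Summable fun n : ℕ => D.twistedPullback (ε * n) τ x := by
    obtain ⟨N, hN⟩ := hfin x
    refine summable_of_hasFiniteSupport ((Set.finite_lt_nat N).subset fun n hn => ?_)
    by_contra hle
    exact hn (hN.self_of_nhds n (not_lt.1 hle))
  refine ⟨fun x => ∑' n : ℕ, D.twistedPullback (ε * n) τ x,
    ⟨contDiff_iff_contDiffAt.2 fun x => ?_, fun m x => ?_⟩, funext fun x => ?_⟩
  · obtain ⟨N, hN⟩ := hfin x
    have hpartial :
        ContDiffAt ℝ ∞ (fun y => ∑ n ∈ Finset.range N, D.twistedPullback (ε * n) τ y) x :=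
      ContDiffAt.sum fun n _ => (twistedPullback_mem_periodicForms _ h).1.contDiffAt
    refine hpartial.congr_of_eventuallyEq ?_
    filter_upwards [hN] with y hy
    exact tsum_eq_sum fun n hn => hy n (by simpa using hn)
  · exact tsum_congr fun n => (twistedPullback_mem_periodicForms _ h).2 m x
  · have hsucc (n : ℕ) : ε + ε * n = ε * (n + 1 : ℕ) := by push_cast; ring
    simp only [Pi.sub_apply, twistedPullback_tsum ε x (hsum _), twistedPullback_twistedPullback,
      hsucc]
    rw [(hsum x).tsum_eq_zero_add, add_sub_cancel_right, Nat.cast_zero, mul_zero,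
      twistedPullback_zero]

lemma exists_sub_twistedPullback_eq_of_support_le (h : τ ∈ D.periodicForms k)
    (hsupp : ∀ x, 1 ≤ height x → τ x = 0) :
    ∃ ν ∈ D.periodicForms k, ν - D.twistedPullback 1 ν = τ := by
  refine exists_sub_twistedPullback_eq_of_locallyFinite 1 h fun x => ?_
  obtain ⟨N, hN⟩ := exists_nat_gt (2 - height x)
  refine ⟨N, ?_⟩
  filter_upwards [height.continuous.isOpen_preimage _ isOpen_Ioi |>.mem_nhds
    (show height x ∈ Set.Ioi (height x - 1) by simp)] with y hy n hn
  have hn' : (N : ℝ) ≤ n := by exact_mod_cast hn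
  rw [Set.mem_preimage, Set.mem_Ioi] at hy
  have hzero : τ (D.deckMap (1 * n) y) = 0 := hsupp _ <| by
    rw [height_deckMap]
    push_cast
    linarith
  rw [twistedPullback_apply, hzero]
  exact smul_zero _

lemma exists_sub_twistedPullback_eq_of_le_support (h : τ ∈ D.periodicForms k)
    (hsupp : ∀ x, height x ≤ 0 → τ x = 0) :
    ∃ ν ∈ D.periodicForms k, ν - D.twistedPullback (-1) ν = τ := by
  refine exists_sub_twistedPullback_eq_of_locallyFinite (-1) h fun x => ?_
  obtain ⟨N, hN⟩ := exists_nat_gt (height x + 1)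
  refine ⟨N, ?_⟩
  filter_upwards [height.continuous.isOpen_preimage _ isOpen_Iio |>.mem_nhds
    (show height x ∈ Set.Iio (height x + 1) by simp)] with y hy n hn
  have hn' : (N : ℝ) ≤ n := by exact_mod_cast hn
  rw [Set.mem_preimage, Set.mem_Iio] at hy
  have hzero : τ (D.deckMap (-1 * n) y) = 0 := hsupp _ <| by
    rw [height_deckMap]
    push_cast
    linarith
  rw [twistedPullback_apply, hzero]
  exact smul_zero _

lemma smul_mem_periodicForms {f : ℝ → ℝ} (hf : ContDiff ℝ ∞ f) (h : τ ∈ D.periodicForms k) :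
    (fun x => f (height x) • τ x) ∈ D.periodicForms k :=
  ⟨(hf.comp height.contDiff).smul h.1, fun m x => by
    simp only [map_add, height_lattice, add_zero, h.2]⟩

/-- Cut `τ` into two pieces, supported in `y ≤ 1` and `y ≥ 0`, on which the geometric series of the
twisted pullback and of its inverse are respectively locally finite. -/
lemma exists_sub_twistedPullback_eq (h : τ ∈ D.periodicForms k) :
    ∃ ν ∈ D.periodicForms k, ν - D.twistedPullback 1 ν = τ := by
  obtain ⟨ν₁, hν₁, e₁⟩ := exists_sub_twistedPullback_eq_of_support_le
    (smul_mem_periodicForms (contDiff_const.sub Real.smoothTransition.contDiff) h)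
    fun x hx => by rw [Real.smoothTransition.one_of_one_le hx, sub_self, zero_smul]
  obtain ⟨ν₂, hν₂, e₂⟩ := exists_sub_twistedPullback_eq_of_le_support
    (smul_mem_periodicForms Real.smoothTransition.contDiff h)
    fun x hx => by rw [Real.smoothTransition.zero_of_nonpos hx, zero_smul]
  refine ⟨ν₁ - D.twistedPullback (-1) ν₂,
    sub_mem hν₁ (twistedPullback_mem_periodicForms _ hν₂), ?_⟩
  rw [map_sub, twistedPullback_twistedPullback, add_neg_cancel, twistedPullback_zero,
    sub_sub_sub_comm, e₁, ← neg_sub ν₂, e₂, sub_neg_eq_add]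
  funext x
  rw [Pi.add_apply, ← add_smul, sub_add_cancel, one_smul]

end InoueData

end Inoue

/-! ### Constant forms -/

namespace MorseNovikov

variable {E F : Type*} [NormedAddCommGroup E] [NormedSpace ℝ E] [FiniteDimensional ℝ E]
  [NormedAddCommGroup F] [NormedSpace ℝ F] [FiniteDimensional ℝ F]

instance finiteDimensional_continuousAlternatingMap (k : ℕ) :
    FiniteDimensional ℝ (E [⋀^Fin k]→L[ℝ] F) :=
  Module.Finite.of_injective
    (ContinuousMultilinearMap.toMultilinearMapLinear.comp
      (ContinuousAlternatingMap.toContinuousMultilinearMapLinear (R := ℝ) (A := ℝ)))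
    (ContinuousMultilinearMap.toMultilinearMap_injective.comp
      ContinuousAlternatingMap.toContinuousMultilinearMap_injective)

lemma exists_sub_eq_of_forall_fixed_eq_zero {K V : Type*} [Field K] [AddCommGroup V] [Module K V]
    [FiniteDimensional K V] (S : V →ₗ[K] V) {W : Submodule K V} (hW : ∀ w ∈ W, S w ∈ W)
    (hfix : ∀ w ∈ W, S w = w → w = 0) {m : V} (hm : m ∈ W) : ∃ w ∈ W, w - S w = m := by
  let R : W →ₗ[K] W := LinearMap.id - S.restrict hW
  have hR : Function.Injective R := (injective_iff_map_eq_zero R).2 fun w hw =>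
    Subtype.ext (hfix w w.2 (sub_eq_zero.1 (congrArg Subtype.val hw)).symm)
  obtain ⟨w, hw⟩ := LinearMap.injective_iff_surjective.1 hR ⟨m, hm⟩
  exact ⟨w, w.2, congrArg Subtype.val hw⟩

lemma eq_zero_of_eq_mul_comp_mul {β : ℂ} (hβ : β.im ≠ 0) {r : ℝ} (hr : r ≠ 0) {ψ : ℂ →ₗ[ℝ] ℝ}
    (h : ∀ z, ψ z = r * ψ (β * z)) : ψ = 0 := by
  have hne : 1 - r * β ≠ 0 := fun h0 => by
    simpa [hr, hβ] using congrArg Complex.im h0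
  ext1 z
  have hz : z / (1 - r * β) - r • (β * (z / (1 - r * β))) = z := by
    rw [Complex.real_smul]
    field_simp
  rw [← hz, map_sub, map_smul, smul_eq_mul, ← h, sub_self, LinearMap.zero_apply]

end MorseNovikov

namespace Inoue

open MorseNovikov

variable {k : ℕ}

/-- The area form `(i/2) dz ∧ dz̄` of the `z`-plane. -/
def areaForm : (ℂ × ℂ) [⋀^Fin 2]→L[ℝ] ℝ :=
  wedgeAt
    (ContinuousAlternatingMap.ofSubsingleton ℝ (ℂ × ℂ) ℝ (0 : Fin 1)
      (Complex.reCLM.comp (ContinuousLinearMap.fst ℝ ℂ ℂ)))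
    (ContinuousAlternatingMap.ofSubsingleton ℝ (ℂ × ℂ) ℝ (0 : Fin 1)
      (Complex.imCLM.comp (ContinuousLinearMap.fst ℝ ℂ ℂ)))

lemma areaForm_apply (v : Fin 2 → ℂ × ℂ) :
    areaForm v = (v 0).1.re * (v 1).1.im - (v 1).1.re * (v 0).1.im := by
  simp [areaForm, wedgeAt, ContinuousAlternatingMap.alternatizeUncurryFin_apply, Fin.removeNth]
  ring

/-- The coefficient of `areaForm` in a two-form, read off the oriented unit square of the
`z`-plane. -/
def areaCoeff : ((ℂ × ℂ) [⋀^Fin 2]→L[ℝ] ℝ) →ₗ[ℝ] ℝ where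
  toFun c := c ![(1, 0), (Complex.I, 0)]
  map_add' _ _ := rfl
  map_smul' _ _ := rfl

lemma areaCoeff_apply (c : (ℂ × ℂ) [⋀^Fin 2]→L[ℝ] ℝ) :
    areaCoeff c = c ![(1, 0), (Complex.I, 0)] := rfl

lemma areaCoeff_areaForm : areaCoeff areaForm = 1 := by
  simp [areaCoeff_apply, areaForm_apply]

lemma areaForm_mem_horizontalForms : areaForm ∈ horizontalForms 2 := by
  change areaForm.compContinuousLinearMap horizontalProj = areaForm
  ext v
  simp [areaForm_apply, horizontalProj, vertical]

lemma apply_eq_areaCoeff_mul (c : (ℂ × ℂ) [⋀^Fin 2]→L[ℝ] ℝ) {v : Fin 2 → ℂ × ℂ}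
    (hv : ∀ i, (v i).2 = 0) : c v = areaCoeff c * areaForm v := by
  let f := c.toAlternatingMap.compLinearMap (LinearMap.inl ℝ ℂ ℂ)
  have hf : f = areaCoeff c • Complex.basisOneI.det := by
    rw [f.eq_smul_basis_det Complex.basisOneI, areaCoeff_apply]
    congr 1
    refine congrArg c (funext fun i => ?_)
    fin_cases i <;> simp
  have hcv : c v = f fun i => (v i).1 :=
    congrArg c (funext fun i => Prod.ext rfl (hv i))
  rw [hcv, hf, AlternatingMap.smul_apply, Module.Basis.det_apply, Matrix.det_fin_two,
    areaForm_apply, smul_eq_mul]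
  simp [Module.Basis.toMatrix_apply]

/-- The vector `∂/∂x`. -/
def unitX : ℂ × ℂ := (0, 1)

lemma height_unitX : height unitX = 0 := by simp [height_apply, unitX]

lemma eq_inl_add_smul_unitX {v : ℂ × ℂ} (hv : height v = 0) :
    v = (v.1, 0) + v.2.re • unitX := by
  rw [height_apply] at hv
  refine Prod.ext ?_ (Complex.ext ?_ ?_) <;> simp [unitX, hv]

lemma interiorProduct_mem_horizontalForms {c : (ℂ × ℂ) [⋀^Fin (k + 1)]→L[ℝ] ℝ}
    (hc : c ∈ horizontalForms (k + 1)) {u : ℂ × ℂ} (hu : height u = 0) :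
    interiorProduct u c ∈ horizontalForms k := by
  change (interiorProduct u c).compContinuousLinearMap horizontalProj = interiorProduct u c
  ext v
  have hcons : (fun i => horizontalProj (Matrix.vecCons u v i)) =
      Matrix.vecCons u (horizontalProj ∘ v) := by
    refine (Fin.comp_cons horizontalProj u v).trans ?_
    rw [show horizontalProj u = u by simp [horizontalProj, hu]]
    rfl
  exact (congrArg c hcons.symm).trans (apply_horizontalProj hc (Matrix.vecCons u v))

lemma eq_zero_of_four_le {c : (ℂ × ℂ) [⋀^Fin k]→L[ℝ] ℝ} (hk : 4 ≤ k)
    (hc : c ∈ horizontalForms k) : c = 0 := by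
  have hne : height.toLinearMap ≠ 0 := fun h0 =>
    one_ne_zero (height_vertical.symm.trans (congrArg (fun f => f vertical) h0))
  have hker := Module.Dual.finrank_ker_add_one_of_ne_zero hne
  refine eq_zero_of_mem_horizontalForms hc fun v hv => ?_
  refine c.toAlternatingMap.map_linearDependent v fun hli => ?_
  have hspan : Submodule.span ℝ (Set.range v) ≤ LinearMap.ker height.toLinearMap :=
    Submodule.span_le.2 (Set.range_subset_iff.2 hv)
  have hcard := Submodule.finrank_mono hspan
  rw [finrank_span_eq_card hli, Fintype.card_fin] at hcard
  rw [Module.finrank_prod, Complex.finrank_real_complex] at hker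
  lia

namespace InoueData

variable (D : InoueData)

/-- The transpose of `A`, which is `deckLinear 1` in the basis of `ℂ × ℝ` given by the lattice. -/
def latticeShift : (Fin 3 → ℝ) →ₗ[ℝ] (Fin 3 → ℝ) :=
  Matrix.toLin' (D.A.1.map (Int.cast : ℤ → ℝ))ᵀ

lemma deckLinear_one_lattice (x : Fin 3 → ℝ) :
    D.deckLinear 1 (D.lattice x) = D.lattice (D.latticeShift x) := by
  suffices h : (D.deckLinear 1).toLinearMap.comp D.lattice = D.lattice.comp D.latticeShift from
    congrArg (fun f => f x) h
  refine (Pi.basisFun ℝ (Fin 3)).ext fun i => ?_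
  have hsingle : (fun j => ((Pi.single i 1 : Fin 3 → ℤ) j : ℝ)) = Pi.basisFun ℝ (Fin 3) i := by
    funext j
    simp [Pi.single_apply]
  have hi := D.deckLinear_lattice 1 (Pi.single i 1)
  rw [hsingle] at hi
  rw [LinearMap.comp_apply, ContinuousLinearMap.coe_coe, hi, LinearMap.comp_apply]
  congr 1
  funext j
  simp [latticeShift]

lemma det_latticeShift : LinearMap.det D.latticeShift = 1 := by
  have h := RingHom.map_det (Int.castRingHom ℝ) D.A.1
  rw [D.A.2, map_one] at h
  rw [latticeShift, LinearMap.det_toLin', Matrix.det_transpose]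
  exact h.symm

lemma α_mul_normSq_β : D.α * Complex.normSq D.β = 1 := by
  let e : (Fin 3 → ℝ) ≃ₗ[ℝ] ℂ × ℝ :=
    LinearEquiv.ofInjectiveOfFinrankEq D.period (LinearMap.ker_eq_bot.1 D.ker_period) (by simp)
  let f : ℂ × ℝ →ₗ[ℝ] ℂ × ℝ :=
    LinearMap.prodMap (LinearMap.mul ℝ ℂ D.β) (LinearMap.mul ℝ ℝ D.α)
  have hf : f = (e : (Fin 3 → ℝ) →ₗ[ℝ] ℂ × ℝ) ∘ₗ D.latticeShift ∘ₗ
      (e.symm : ℂ × ℝ →ₗ[ℝ] (Fin 3 → ℝ)) := by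
    refine LinearMap.ext fun u => ?_
    obtain ⟨x, rfl⟩ := e.surjective u
    have h := D.deckLinear_one_lattice x
    have hfst := congrArg Prod.fst h
    have hre := congrArg (fun v : ℂ × ℂ => v.2.re) h
    simp only [deckLinear_fst, deckLinear_re, zpow_one] at hfst hre
    rw [LinearMap.comp_apply, LinearMap.comp_apply, LinearEquiv.coe_coe, LinearEquiv.coe_coe,
      LinearEquiv.symm_apply_apply]
    exact Prod.ext hfst hre
  have hdet : LinearMap.det f = 1 := by rw [hf, LinearMap.det_conj, det_latticeShift]
  have hβ : LinearMap.det (LinearMap.mul ℝ ℂ D.β) = Complex.normSq D.β :=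
    Algebra.norm_complex_apply D.β
  have hα : LinearMap.det (LinearMap.mul ℝ ℝ D.α) = D.α := by simp
  rw [LinearMap.det_prodMap, hβ, hα, mul_comm] at hdet
  exact hdet

/-- The restriction of `twistedPullback 1` to constant forms. -/
def constPullback (k : ℕ) :
    ((ℂ × ℂ) [⋀^Fin k]→L[ℝ] ℝ) →ₗ[ℝ] ((ℂ × ℂ) [⋀^Fin k]→L[ℝ] ℝ) :=
  D.α • (ContinuousAlternatingMap.compContinuousLinearMapCLM (D.deckLinear 1)).toLinearMap

variable {c m : (ℂ × ℂ) [⋀^Fin k]→L[ℝ] ℝ}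

lemma constPullback_apply (c : (ℂ × ℂ) [⋀^Fin k]→L[ℝ] ℝ) (v : Fin k → ℂ × ℂ) :
    D.constPullback k c v = D.α * c fun i => D.deckLinear 1 (v i) := rfl

lemma twistedPullback_const (c : (ℂ × ℂ) [⋀^Fin k]→L[ℝ] ℝ) :
    D.twistedPullback 1 (fun _ => c) = fun _ => D.constPullback k c := by
  funext x
  rw [twistedPullback_apply, zpow_one]
  rfl

lemma deckLinear_horizontalProj (n : ℤ) (v : ℂ × ℂ) :
    D.deckLinear n (horizontalProj v) = horizontalProj (D.deckLinear n v) := by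
  simp [horizontalProj, height_deckLinear, deckLinear_vertical]

lemma constPullback_mem_horizontalForms (hc : c ∈ horizontalForms k) :
    D.constPullback k c ∈ horizontalForms k := by
  change (D.constPullback k c).compContinuousLinearMap horizontalProj = D.constPullback k c
  ext v
  rw [ContinuousAlternatingMap.compContinuousLinearMap_apply, constPullback_apply,
    constPullback_apply, ← apply_horizontalProj hc fun i => D.deckLinear 1 (v i)]
  simp only [Function.comp_apply, deckLinear_horizontalProj]

lemma deckLinear_one_inl (z : ℂ) : D.deckLinear 1 (z, 0) = (D.β * z, 0) := by
  simp [deckLinear]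

lemma deckLinear_one_unitX : D.deckLinear 1 unitX = D.α • unitX := by
  simp [deckLinear, unitX]

lemma constPullback_areaForm : D.constPullback 2 areaForm = areaForm := by
  have h := D.α_mul_normSq_β
  rw [Complex.normSq_apply] at h
  ext v
  simp only [constPullback_apply, areaForm_apply, deckLinear_fst, zpow_one, Complex.mul_im,
    Complex.mul_re]
  linear_combination ((v 0).1.re * (v 1).1.im - (v 1).1.re * (v 0).1.im) * h

lemma areaCoeff_constPullback (c : (ℂ × ℂ) [⋀^Fin 2]→L[ℝ] ℝ) :
    areaCoeff (D.constPullback 2 c) = areaCoeff c := by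
  let v : Fin 2 → ℂ × ℂ := ![(1, 0), (Complex.I, 0)]
  have hv (i) : (D.deckLinear 1 (v i)).2 = 0 := by
    fin_cases i <;> simp [v, deckLinear_one_inl]
  calc areaCoeff (D.constPullback 2 c) = D.α * c fun i => D.deckLinear 1 (v i) := rfl
    _ = areaCoeff c * D.constPullback 2 areaForm v := by
      rw [apply_eq_areaCoeff_mul c hv, constPullback_apply, mul_left_comm]
    _ = areaCoeff c := by
      rw [constPullback_areaForm, ← areaCoeff_apply, areaCoeff_areaForm, mul_one]

lemma apply_eq_of_constPullback_eq (h : D.constPullback k c = c) (v : Fin k → ℂ × ℂ) :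
    D.α * c (fun i => D.deckLinear 1 (v i)) = c v :=
  congrArg (fun f => f v) h

lemma eq_zero_of_constPullback_zero_eq {c : (ℂ × ℂ) [⋀^Fin 0]→L[ℝ] ℝ}
    (h : D.constPullback 0 c = c) : c = 0 := by
  ext v
  refine eq_zero_of_mul_eq_self_left D.one_lt_α.ne' ?_
  exact (congrArg (fun u => D.α * c u) (Subsingleton.elim _ _)).trans
    (D.apply_eq_of_constPullback_eq h v)

lemma eq_zero_of_eq_mul_apply_deckLinear {c : (ℂ × ℂ) [⋀^Fin 1]→L[ℝ] ℝ}
    (hc : c ∈ horizontalForms 1) {r : ℝ} (hr : r ≠ 0) (hrα : r * D.α ≠ 1)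
    (h : ∀ v, c v = r * c fun i => D.deckLinear 1 (v i)) : c = 0 := by
  let ψ : ℂ × ℂ →L[ℝ] ℝ := (ContinuousAlternatingMap.ofSubsingleton ℝ (ℂ × ℂ) ℝ (0 : Fin 1)).symm c
  have hψ (v : Fin 1 → ℂ × ℂ) : c v = ψ (v 0) :=
    congrArg c (funext fun i => congrArg v (Subsingleton.elim i 0))
  have hdeck (v : ℂ × ℂ) : ψ v = r * ψ (D.deckLinear 1 v) := h fun _ => v
  have hfst : ψ.toLinearMap.comp (LinearMap.inl ℝ ℂ ℂ) = 0 :=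
    eq_zero_of_eq_mul_comp_mul D.β_im_ne_zero hr fun z =>
      (hdeck (z, 0)).trans (by rw [deckLinear_one_inl]; rfl)
  have hunitX : ψ unitX = 0 := by
    refine eq_zero_of_mul_eq_self_left hrα ?_
    rw [mul_assoc, ← smul_eq_mul D.α, ← map_smul, ← deckLinear_one_unitX, ← hdeck]
  refine eq_zero_of_mem_horizontalForms hc fun v hv => ?_
  rw [hψ, eq_inl_add_smul_unitX (hv 0), map_add, map_smul, hunitX, smul_zero, add_zero]
  exact congrArg (fun f => f (v 0).1) hfst

lemma eq_zero_of_constPullback_three_eq {c : (ℂ × ℂ) [⋀^Fin 3]→L[ℝ] ℝ}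
    (hc : c ∈ horizontalForms 3) (h : D.constPullback 3 c = c) : c = 0 := by
  refine eq_zero_of_mem_horizontalForms hc fun v hv => ?_
  choose x hx using fun i => D.exists_lattice_eq (hv i)
  obtain rfl : v = fun i => D.lattice (x i) := funext fun i => (hx i).symm
  let f := c.toAlternatingMap.compLinearMap D.lattice
  have hdet : f (D.latticeShift ∘ x) = f x := by
    rw [f.eq_smul_basis_det (Pi.basisFun ℝ (Fin 3)), AlternatingMap.smul_apply,
      AlternatingMap.smul_apply, Module.Basis.det_comp, det_latticeShift, one_mul]
  refine eq_zero_of_mul_eq_self_left D.one_lt_α.ne' ?_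
  calc D.α * f x = D.α * c fun i => D.deckLinear 1 (D.lattice (x i)) := by
        rw [← hdet]
        simp only [deckLinear_one_lattice]
        rfl
    _ = c fun i => D.lattice (x i) := D.apply_eq_of_constPullback_eq h _

lemma eq_zero_of_constPullback_eq (hk : k ≠ 2) (hc : c ∈ horizontalForms k)
    (h : D.constPullback k c = c) : c = 0 := by
  match k with
  | 0 => exact D.eq_zero_of_constPullback_zero_eq h
  | 1 =>
    exact D.eq_zero_of_eq_mul_apply_deckLinear hc D.α_pos.ne'
      (one_lt_mul_of_lt_of_le D.one_lt_α D.one_lt_α.le).ne' fun v =>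
        (D.apply_eq_of_constPullback_eq h v).symm
  | 3 => exact D.eq_zero_of_constPullback_three_eq hc h
  | _ + 4 => exact eq_zero_of_four_le (by lia) hc

lemma interiorProduct_unitX_eq_zero {c : (ℂ × ℂ) [⋀^Fin 2]→L[ℝ] ℝ} (hc : c ∈ horizontalForms 2)
    (h : D.constPullback 2 c = c) : interiorProduct unitX c = 0 := by
  have hα := D.one_lt_α
  refine D.eq_zero_of_eq_mul_apply_deckLinear (r := D.α * D.α)
    (interiorProduct_mem_horizontalForms hc height_unitX) (by positivity)
    (one_lt_mul_of_lt_of_le (one_lt_mul_of_lt_of_le hα hα.le) hα.le).ne' fun v => ?_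
  have hcons : (fun i => D.deckLinear 1 (Matrix.vecCons unitX v i)) =
      Matrix.vecCons (D.α • unitX) fun i => D.deckLinear 1 (v i) := by
    rw [← deckLinear_one_unitX]
    exact Fin.comp_cons _ _ _
  have hfix := D.apply_eq_of_constPullback_eq h (Matrix.vecCons unitX v)
  rw [hcons, ContinuousAlternatingMap.vecCons_smul, smul_eq_mul, ← mul_assoc] at hfix
  exact hfix.symm

lemma eq_areaCoeff_smul_areaForm {c : (ℂ × ℂ) [⋀^Fin 2]→L[ℝ] ℝ} (hc : c ∈ horizontalForms 2)
    (h : D.constPullback 2 c = c) : c = areaCoeff c • areaForm := by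
  let ℓ : ℂ × ℂ →L[ℝ] ℝ := Complex.reCLM.comp (ContinuousLinearMap.snd ℝ ℂ ℂ)
  have hℓ := compContinuousLinearMap_eq_of_interiorProduct_eq_zero (ℓ := ℓ)
    (D.interiorProduct_unitX_eq_zero hc h)
  refine sub_eq_zero.1 (eq_zero_of_mem_horizontalForms
    (sub_mem hc (Submodule.smul_mem _ _ areaForm_mem_horizontalForms)) fun v hv => ?_)
  rw [ContinuousAlternatingMap.sub_apply, sub_eq_zero]
  let w (i : Fin 2) : ℂ × ℂ := v i - ℓ (v i) • unitX
  have hw (i) : (w i).2 = 0 := by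
    have := hv i
    rw [height_apply] at this
    refine Complex.ext ?_ ?_ <;> simp [w, ℓ, unitX, this]
  calc c v = c w := congrArg (fun f => f v) hℓ.symm
    _ = areaCoeff c * areaForm w := apply_eq_areaCoeff_mul c hw
    _ = areaCoeff c * areaForm v := by simp [w, areaForm_apply, unitX]

lemma exists_sub_constPullback_eq (hk : k ≠ 2) (hm : m ∈ horizontalForms k) :
    ∃ c ∈ horizontalForms k, c - D.constPullback k c = m :=
  exists_sub_eq_of_forall_fixed_eq_zero (D.constPullback k)
    (fun _ => D.constPullback_mem_horizontalForms) (fun _ => D.eq_zero_of_constPullback_eq hk) hm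

lemma exists_sub_constPullback_two_eq {m : (ℂ × ℂ) [⋀^Fin 2]→L[ℝ] ℝ}
    (hm : m ∈ horizontalForms 2) :
    ∃ c ∈ horizontalForms 2, c - D.constPullback 2 c = m - areaCoeff m • areaForm := by
  obtain ⟨c, hc, h⟩ := exists_sub_eq_of_forall_fixed_eq_zero (D.constPullback 2)
    (W := horizontalForms 2 ⊓ LinearMap.ker areaCoeff)
    (m := m - areaCoeff m • areaForm)
    (fun c hc => ⟨D.constPullback_mem_horizontalForms hc.1,
      (D.areaCoeff_constPullback c).trans hc.2⟩)
    (fun c hc h => by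
      rw [D.eq_areaCoeff_smul_areaForm hc.1 h, LinearMap.mem_ker.1 hc.2, zero_smul])
    ⟨sub_mem hm (Submodule.smul_mem _ _ areaForm_mem_horizontalForms),
      by simp [areaCoeff_areaForm]⟩
  exact ⟨c, hc.1, h⟩

end InoueData

end Inoue

/-! ### Invariant forms on the universal cover -/

namespace MorseNovikov

variable {E F : Type*} [NormedAddCommGroup E] [NormedSpace ℝ E] [NormedAddCommGroup F]
  [NormedSpace ℝ F]

lemma eq_const_of_extDeriv_eq_zero {τ : E → E [⋀^Fin 0]→L[ℝ] F} (h : Differentiable ℝ τ)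
    (hclosed : extDeriv τ = 0) : τ = fun _ => τ 0 := by
  have hfderiv (x : E) : fderiv ℝ τ x = 0 := by
    ext v w
    have hx := congrArg (fun c => c ![v]) (congrFun hclosed x)
    simp only [extDeriv, ContinuousAlternatingMap.alternatizeUncurryFin_apply] at hx
    rw [Subsingleton.elim w ![]]
    simpa using hx
  exact funext fun x => is_const_of_fderiv_eq_zero h hfderiv x 0

end MorseNovikov

namespace Inoue

open MorseNovikov

lemma mem_horizontalForms_zero (c : (ℂ × ℂ) [⋀^Fin 0]→L[ℝ] ℝ) : c ∈ horizontalForms 0 := by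
  change c.compContinuousLinearMap horizontalProj = c
  ext v
  exact congrArg c (Subsingleton.elim _ _)

/-- The form `y · areaForm`; its differential represents the generator in degree three. -/
def heightArea : CoverForm 2 := fun x => height x • areaForm

namespace InoueData

variable (D : InoueData) {k : ℕ}

/-- The periodic forms fixed by `twistedPullback 1`. Dividing them by `αʸ` gives the forms on
`ℂ × ℍ` which descend to the Inoue surface. -/
def invariantForms (k : ℕ) : Submodule ℝ (CoverForm k) :=
  D.periodicForms k ⊓ LinearMap.eqLocus (D.twistedPullback 1) LinearMap.id

variable {D}

lemma mem_invariantForms {τ : CoverForm k} :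
    τ ∈ D.invariantForms k ↔ τ ∈ D.periodicForms k ∧ D.twistedPullback 1 τ = τ := Iff.rfl

lemma mem_invariantForms_of_sub_eq_zero {τ : CoverForm k} (hτ : τ ∈ D.periodicForms k)
    (h : τ - D.twistedPullback 1 τ = 0) : τ ∈ D.invariantForms k :=
  ⟨hτ, (sub_eq_zero.1 h).symm⟩

lemma extDeriv_sub_twistedPullback {τ : CoverForm k} (h : τ ∈ D.periodicForms k) :
    extDeriv (τ - D.twistedPullback 1 τ) = extDeriv τ - D.twistedPullback 1 (extDeriv τ) := by
  rw [extDeriv_sub_of_mem_periodicForms h (twistedPullback_mem_periodicForms 1 h),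
    extDeriv_twistedPullback 1 (differentiable_of_mem_periodicForms h)]

lemma eq_zero_of_extDeriv_eq_zero {τ : CoverForm 0} (h : τ ∈ D.invariantForms 0)
    (hclosed : extDeriv τ = 0) : τ = 0 := by
  have hconst := eq_const_of_extDeriv_eq_zero (differentiable_of_mem_periodicForms h.1) hclosed
  have hT := (mem_invariantForms.1 h).2
  rw [hconst, twistedPullback_const] at hT
  rw [hconst, D.eq_zero_of_constPullback_zero_eq (congrFun hT 0)]
  rfl

lemma constPullback_eq_of_invariant {τ : CoverForm (k + 1)} (h : D.twistedPullback 1 τ = τ)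
    {c : (ℂ × ℂ) [⋀^Fin (k + 1)]→L[ℝ] ℝ} (hc : c ∈ horizontalForms (k + 1)) {ρ : CoverForm k}
    (hρ : ρ ∈ D.periodicForms k) (hτ : τ = (fun _ => c) + extDeriv ρ) :
    D.constPullback (k + 1) c = c := by
  have hT := twistedPullback_mem_periodicForms 1 hρ
  refine (sub_eq_zero.1 (eq_zero_of_const_eq_extDeriv
    (sub_mem hc (D.constPullback_mem_horizontalForms hc)) (sub_mem hT hρ) ?_)).symm
  have hTτ : (fun _ => c) + extDeriv ρ =
      (fun _ => D.constPullback (k + 1) c) + extDeriv (D.twistedPullback 1 ρ) := by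
    rw [← hτ, ← h, hτ, map_add, twistedPullback_const,
      extDeriv_twistedPullback 1 (differentiable_of_mem_periodicForms hρ)]
  rw [extDeriv_sub_of_mem_periodicForms hT hρ]
  exact sub_eq_sub_iff_add_eq_add.2 (hTτ.trans (add_comm _ _))

lemma exists_sub_twistedPullback_eq_const {ρ : CoverForm k} (hρ : ρ ∈ D.periodicForms k)
    (h : D.twistedPullback 1 (extDeriv ρ) = extDeriv ρ) :
    ∃ m ∈ horizontalForms k, ∃ ρ' ∈ D.periodicForms k, extDeriv ρ' = extDeriv ρ ∧
      ρ' - D.twistedPullback 1 ρ' = fun _ => m := by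
  have hsub := sub_mem hρ (twistedPullback_mem_periodicForms 1 hρ)
  have hclosed : extDeriv (ρ - D.twistedPullback 1 ρ) = 0 := by
    rw [extDeriv_sub_twistedPullback hρ, h, sub_self]
  cases k with
  | zero =>
    exact ⟨_, mem_horizontalForms_zero _, ρ, hρ, rfl,
      eq_const_of_extDeriv_eq_zero (differentiable_of_mem_periodicForms hsub) hclosed⟩
  | succ k =>
    obtain ⟨m, hm, μ, hμ, hmμ⟩ := exists_eq_const_add hsub hclosed
    obtain ⟨ν, hν, hνμ⟩ := exists_sub_twistedPullback_eq hμ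
    have hdν := extDeriv_mem_periodicForms hν
    refine ⟨m, hm, ρ - extDeriv ν, sub_mem hρ hdν, ?_, ?_⟩
    · rw [extDeriv_sub_of_mem_periodicForms hρ hdν, extDeriv_extDeriv hν.1 two_le_infty, sub_zero]
    · rw [map_sub, sub_sub_sub_comm, hmμ, ← extDeriv_sub_twistedPullback hν, hνμ,
        add_sub_cancel_right]

lemma extDeriv_sub_const {τ : CoverForm k} (h : τ ∈ D.periodicForms k)
    (c : (ℂ × ℂ) [⋀^Fin k]→L[ℝ] ℝ) : extDeriv (τ - fun _ => c) = extDeriv τ := by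
  rw [extDeriv_sub_of_mem_periodicForms h (const_mem_periodicForms c), extDeriv_const, sub_zero]

lemma exists_invariant_primitive {ρ : CoverForm k} (hk : k ≠ 2) (hρ : ρ ∈ D.periodicForms k)
    (h : D.twistedPullback 1 (extDeriv ρ) = extDeriv ρ) :
    ∃ ρ' ∈ D.invariantForms k, extDeriv ρ' = extDeriv ρ := by
  obtain ⟨m, hm, ρ', hρ', hd, hT⟩ := exists_sub_twistedPullback_eq_const hρ h
  obtain ⟨c, -, hcm⟩ := D.exists_sub_constPullback_eq hk hm
  refine ⟨ρ' - fun _ => c, mem_invariantForms_of_sub_eq_zero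
    (sub_mem hρ' (const_mem_periodicForms c)) ?_, (extDeriv_sub_const hρ' c).trans hd⟩
  rw [map_sub, sub_sub_sub_comm, hT, twistedPullback_const, ← hcm]
  exact sub_self _

lemma heightArea_mem_periodicForms : heightArea ∈ D.periodicForms 2 :=
  smul_mem_periodicForms contDiff_id (const_mem_periodicForms areaForm)

lemma heightArea_sub_twistedPullback :
    heightArea - D.twistedPullback 1 heightArea = fun _ => -areaForm := by
  funext x
  have hT : D.twistedPullback 1 heightArea x = (height x + 1) • D.constPullback 2 areaForm := by
    ext v
    simp only [twistedPullback_apply, heightArea, height_deckMap, zpow_one, Int.cast_one]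
    exact mul_left_comm _ _ _
  rw [Pi.sub_apply, hT, constPullback_areaForm, heightArea, add_smul, one_smul, sub_add_cancel_left]

lemma exists_eq_smul_extDeriv_heightArea_add {ρ : CoverForm 2} (hρ : ρ ∈ D.periodicForms 2)
    (h : D.twistedPullback 1 (extDeriv ρ) = extDeriv ρ) :
    ∃ r : ℝ, ∃ ρ' ∈ D.invariantForms 2,
      extDeriv ρ = r • extDeriv heightArea + extDeriv ρ' := by
  obtain ⟨m, hm, ρ', hρ', hd, hT⟩ := exists_sub_twistedPullback_eq_const hρ h
  obtain ⟨c, -, hcm⟩ := D.exists_sub_constPullback_two_eq hm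
  have hc := sub_mem hρ' (const_mem_periodicForms (D := D) c)
  have hH : areaCoeff m • heightArea ∈ D.periodicForms 2 :=
    Submodule.smul_mem _ _ heightArea_mem_periodicForms
  refine ⟨-areaCoeff m, ρ' - (fun _ => c) + areaCoeff m • heightArea,
    mem_invariantForms_of_sub_eq_zero (add_mem hc hH) ?_, ?_⟩
  · have hcT : (fun _ : ℂ × ℂ => c) - D.twistedPullback 1 (fun _ => c) =
        fun _ => m - areaCoeff m • areaForm := by
      rw [twistedPullback_const, ← hcm]
      rfl
    have hHT : areaCoeff m • heightArea - D.twistedPullback 1 (areaCoeff m • heightArea) =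
        fun _ => -(areaCoeff m • areaForm) := by
      rw [map_smul]
      exact (smul_sub (areaCoeff m) heightArea _).symm.trans
        ((congrArg (areaCoeff m • ·) heightArea_sub_twistedPullback).trans
          (funext fun _ => smul_neg (areaCoeff m) areaForm))
    rw [map_add, map_sub, add_sub_add_comm, sub_sub_sub_comm, hT, hcT, hHT]
    funext x
    simp
  · have hsmul : extDeriv (areaCoeff m • heightArea) = areaCoeff m • extDeriv heightArea :=
      funext fun _ => extDeriv_smul _ _
    rw [extDeriv_add_of_mem_periodicForms hc hH, extDeriv_sub_const hρ', hd, hsmul, neg_smul]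
    abel

theorem exists_primitive {τ : CoverForm (k + 1)} (h2 : k + 1 ≠ 2) (h3 : k + 1 ≠ 3)
    (h : τ ∈ D.invariantForms (k + 1)) (hclosed : extDeriv τ = 0) :
    ∃ ρ ∈ D.invariantForms k, extDeriv ρ = τ := by
  obtain ⟨c, hc, ρ, hρ, hτ⟩ := exists_eq_const_add h.1 hclosed
  have hT := (mem_invariantForms.1 h).2
  obtain rfl := D.eq_zero_of_constPullback_eq h2 hc (constPullback_eq_of_invariant hT hc hρ hτ)
  have hdρ : extDeriv ρ = τ := by
    rw [hτ]
    exact (zero_add _).symm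
  rw [← hdρ] at hT ⊢
  exact exists_invariant_primitive (by lia) hρ hT

theorem exists_eq_smul_areaForm_add {τ : CoverForm 2} (h : τ ∈ D.invariantForms 2)
    (hclosed : extDeriv τ = 0) :
    ∃ r : ℝ, ∃ ρ ∈ D.invariantForms 1, τ = r • (fun _ => areaForm) + extDeriv ρ := by
  obtain ⟨c, hc, ρ, hρ, hτ⟩ := exists_eq_const_add h.1 hclosed
  have hT := (mem_invariantForms.1 h).2
  have hcT := constPullback_eq_of_invariant hT hc hρ hτ
  have hdρ : extDeriv ρ = τ - fun _ => c := by rw [hτ, add_sub_cancel_left]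
  obtain ⟨ρ', hρ', hd⟩ := exists_invariant_primitive (by simp) hρ
    (by rw [hdρ, map_sub, hT, twistedPullback_const, hcT])
  refine ⟨areaCoeff c, ρ', hρ', ?_⟩
  have hc' : (areaCoeff c • fun _ : ℂ × ℂ => areaForm) = fun _ => c :=
    funext fun _ => (D.eq_areaCoeff_smul_areaForm hc hcT).symm
  rw [hd, hdρ, hc', add_sub_cancel]

theorem exists_eq_smul_extDeriv_heightArea_add_of_mem_invariantForms {τ : CoverForm 3}
    (h : τ ∈ D.invariantForms 3) (hclosed : extDeriv τ = 0) :
    ∃ r : ℝ, ∃ ρ ∈ D.invariantForms 2, τ = r • extDeriv heightArea + extDeriv ρ := by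
  obtain ⟨c, hc, ρ, hρ, hτ⟩ := exists_eq_const_add h.1 hclosed
  have hT := (mem_invariantForms.1 h).2
  obtain rfl :=
    D.eq_zero_of_constPullback_eq (by simp) hc (constPullback_eq_of_invariant hT hc hρ hτ)
  have hdρ : extDeriv ρ = τ := by
    rw [hτ]
    exact (zero_add _).symm
  rw [← hdρ] at hT ⊢
  exact exists_eq_smul_extDeriv_heightArea_add hρ hT

lemma areaForm_mem_invariantForms : (fun _ => areaForm) ∈ D.invariantForms 2 :=
  mem_invariantForms.2 ⟨const_mem_periodicForms _,
    by rw [twistedPullback_const, constPullback_areaForm]⟩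

lemma extDeriv_heightArea_mem_invariantForms : extDeriv heightArea ∈ D.invariantForms 3 :=
  mem_invariantForms_of_sub_eq_zero (extDeriv_mem_periodicForms heightArea_mem_periodicForms) <| by
    rw [← extDeriv_sub_twistedPullback heightArea_mem_periodicForms,
      heightArea_sub_twistedPullback, extDeriv_const]

theorem extDeriv_ne_areaForm {ρ : CoverForm 1} (hρ : ρ ∈ D.periodicForms 1) :
    extDeriv ρ ≠ fun _ => areaForm := fun h => by
  have h1 := areaCoeff_areaForm
  rw [eq_zero_of_const_eq_extDeriv areaForm_mem_horizontalForms hρ h.symm, map_zero] at h1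
  exact zero_ne_one h1

/- If `dρ = d(y · areaForm)`, then `ρ - y · areaForm = c + dμ` with `c` constant. Applying `1 - T`
shows that `areaForm - (c - Tc)` is exact, hence zero, although its area coefficient is `1`. -/
theorem extDeriv_ne_extDeriv_heightArea {ρ : CoverForm 2} (hρ : ρ ∈ D.invariantForms 2) :
    extDeriv ρ ≠ extDeriv heightArea := fun h => by
  have hH := heightArea_mem_periodicForms (D := D)
  have hclosed : extDeriv (ρ - heightArea) = 0 := by
    rw [extDeriv_sub_of_mem_periodicForms hρ.1 hH, h, sub_self]
  obtain ⟨c, hc, μ, hμ, hρc⟩ := exists_eq_const_add (sub_mem hρ.1 hH) hclosed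
  have hT : (ρ - heightArea) - D.twistedPullback 1 (ρ - heightArea) = fun _ => areaForm := by
    rw [map_sub, sub_sub_sub_comm, (mem_invariantForms.1 hρ).2, sub_self,
      heightArea_sub_twistedPullback]
    funext x
    simp
  rw [hρc, map_add, add_sub_add_comm, twistedPullback_const,
    ← extDeriv_sub_twistedPullback hμ] at hT
  have hzero : areaForm - (c - D.constPullback 2 c) = 0 :=
    eq_zero_of_const_eq_extDeriv (sub_mem areaForm_mem_horizontalForms
      (sub_mem hc (D.constPullback_mem_horizontalForms hc)))
      (sub_mem hμ (twistedPullback_mem_periodicForms 1 hμ)) (sub_eq_iff_eq_add'.2 hT.symm)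
  have harea := congrArg areaCoeff hzero
  rw [map_sub, map_sub, areaCoeff_constPullback, areaCoeff_areaForm, sub_self, sub_zero,
    map_zero] at harea
  exact one_ne_zero harea

end InoueData

end Inoue

/-! ### Pullbacks to a vector space -/

namespace MorseNovikov

section Functoriality

variable {E : Type*} [NormedAddCommGroup E] [NormedSpace ℝ E]
  {E' : Type*} [NormedAddCommGroup E'] [NormedSpace ℝ E']
  {E'' : Type*} [NormedAddCommGroup E''] [NormedSpace ℝ E'']
  {M : Type*} [TopologicalSpace M] [ChartedSpace E M]
  {N : Type*} [TopologicalSpace N] [ChartedSpace E' N]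
  {P : Type*} [TopologicalSpace P] [ChartedSpace E'' P] {k : ℕ} {f : N → P} {g : M → N}

lemma pullback_eq_of_eventuallyEq_comp {h : M → P} {x : M}
    (hf : MDifferentiableAt 𝓘(ℝ, E') 𝓘(ℝ, E'') f (g x))
    (hg : MDifferentiableAt 𝓘(ℝ, E) 𝓘(ℝ, E') g x) (hh : h =ᶠ[𝓝 x] f ∘ g) (σ : DForm E'' P k) :
    pullback h σ x = ContinuousAlternatingMap.compContinuousLinearMap (pullback f σ (g x))
      (mfderiv 𝓘(ℝ, E) 𝓘(ℝ, E') g x) := by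
  have hderiv (w : TangentSpace 𝓘(ℝ, E) x) : mfderiv 𝓘(ℝ, E) 𝓘(ℝ, E'') h x w =
      mfderiv 𝓘(ℝ, E') 𝓘(ℝ, E'') f (g x) (mfderiv 𝓘(ℝ, E) 𝓘(ℝ, E') g x w) :=
    congrArg (fun T => T w) (hh.mfderiv_eq.trans (mfderiv_comp x hf hg))
  have hσ : (σ (h x) : E'' [⋀^Fin k]→L[ℝ] ℝ) = σ (f (g x)) := by
    rw [hh.self_of_nhds, Function.comp_apply]
  ext v
  change (σ (h x) : E'' [⋀^Fin k]→L[ℝ] ℝ) (fun i => mfderiv 𝓘(ℝ, E) 𝓘(ℝ, E'') h x (v i)) =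
    (σ (f (g x)) : E'' [⋀^Fin k]→L[ℝ] ℝ) fun i =>
      mfderiv 𝓘(ℝ, E') 𝓘(ℝ, E'') f (g x) (mfderiv 𝓘(ℝ, E) 𝓘(ℝ, E') g x (v i))
  rw [hσ]
  simp only [hderiv]
  rfl

lemma pullback_comp (hf : MDifferentiable 𝓘(ℝ, E') 𝓘(ℝ, E'') f)
    (hg : MDifferentiable 𝓘(ℝ, E) 𝓘(ℝ, E') g) (σ : DForm E'' P k) :
    pullback (f ∘ g) σ = (pullback g (pullback f σ : DForm E' N k) : DForm E M k) :=
  funext fun x => pullback_eq_of_eventuallyEq_comp (hf (g x)) (hg x) .rfl σ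

lemma pullback_smul (f : N → P) (c : ℝ) (σ : DForm E'' P k) :
    pullback f (c • σ) = (c • pullback f σ : DForm E' N k) := rfl

end Functoriality

section Pullback

variable {E : Type*} [NormedAddCommGroup E] [NormedSpace ℝ E]
  {E' : Type*} [NormedAddCommGroup E'] [NormedSpace ℝ E']
  {M : Type*} [TopologicalSpace M] [ChartedSpace E M] {k : ℕ}

/-- The `pullback` of a form by a map `f : E' → M`, typed as a function on the vector space `E'`
so that `extDeriv` applies to it. -/
def flatPullback (f : E' → M) (σ : DForm E M k) : E' → E' [⋀^Fin k]→L[ℝ] ℝ :=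
  pullback (E := E') (M := E') f σ

lemma flatPullback_eq_of_eventuallyEq_comp {E'' : Type*} [NormedAddCommGroup E'']
    [NormedSpace ℝ E''] {f : E' → M} {g : E'' → E'} {h : E'' → M} {x : E''} {L : E'' →L[ℝ] E'}
    (hf : MDifferentiableAt 𝓘(ℝ, E') 𝓘(ℝ, E) f (g x)) (hg : HasFDerivAt g L x)
    (hh : h =ᶠ[𝓝 x] f ∘ g) (σ : DForm E M k) :
    flatPullback h σ x = (flatPullback f σ (g x)).compContinuousLinearMap L := by
  rw [← hg.fderiv, ← mfderiv_eq_fderiv]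
  exact pullback_eq_of_eventuallyEq_comp hf hg.differentiableAt.mdifferentiableAt hh σ

variable [IsManifold 𝓘(ℝ, E) ∞ M]

lemma eq_chartRep_comp_mfderiv (σ : DForm E M k) {e : OpenPartialHomeomorph M E}
    (he : e ∈ atlas E M) {x : M} (hx : x ∈ e.source) :
    σ x = ContinuousAlternatingMap.compContinuousLinearMap (chartRep e σ (e x))
      (mfderiv 𝓘(ℝ, E) 𝓘(ℝ, E) e x) := by
  have hsymm (v : TangentSpace 𝓘(ℝ, E) x) : mfderiv 𝓘(ℝ, E) 𝓘(ℝ, E) e.symm (e x)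
      (mfderiv 𝓘(ℝ, E) 𝓘(ℝ, E) e x v) = v :=
    congrArg (fun L => L v) ((mdifferentiable_of_mem_atlas he).symm_comp_deriv hx)
  have hσ : (σ (e.symm (e x)) : E [⋀^Fin k]→L[ℝ] ℝ) = σ x := by rw [e.left_inv hx]
  ext v
  change σ x v = (σ (e.symm (e x)) : E [⋀^Fin k]→L[ℝ] ℝ) fun i =>
    mfderiv 𝓘(ℝ, E) 𝓘(ℝ, E) e.symm (e x) (mfderiv 𝓘(ℝ, E) 𝓘(ℝ, E) e x (v i))
  rw [hσ]
  simp only [hsymm]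
  rfl

variable {f : E' → M} (hf : ContMDiff 𝓘(ℝ, E') 𝓘(ℝ, E) ∞ f) {e : OpenPartialHomeomorph M E}
  (he : e ∈ atlas E M) {u : E'} (hu : f u ∈ e.source)

include hf he hu

lemma fderiv_chart_comp : fderiv ℝ (e ∘ f) u =
    (mfderiv 𝓘(ℝ, E) 𝓘(ℝ, E) e (f u)).comp (mfderiv 𝓘(ℝ, E') 𝓘(ℝ, E) f u) := by
  rw [← mfderiv_eq_fderiv]
  exact mfderiv_comp u (mdifferentiableAt_atlas he hu) (hf.contMDiffAt.mdifferentiableAt (by simp))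

lemma contDiffAt_chart_comp : ContDiffAt ℝ ∞ (e ∘ f) u :=
  ((contMDiffAt_of_mem_maximalAtlas (IsManifold.subset_maximalAtlas he) hu).comp u
    hf.contMDiffAt).contDiffAt

lemma flatPullback_eventuallyEq (σ : DForm E M k) :
    flatPullback f σ =ᶠ[𝓝 u] fun v =>
      (chartRep e σ (e (f v))).compContinuousLinearMap (fderiv ℝ (e ∘ f) v) := by
  filter_upwards [hf.continuous.continuousAt.preimage_mem_nhds (e.open_source.mem_nhds hu)]
    with v hv
  rw [fderiv_chart_comp hf he hv]
  ext w
  change σ (f v) (fun i => mfderiv 𝓘(ℝ, E') 𝓘(ℝ, E) f v (w i)) = _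
  rw [eq_chartRep_comp_mfderiv σ he hv]
  rfl

omit he hu

lemma contDiff_flatPullback [FiniteDimensional ℝ E] {σ : DForm E M k}
    (hσ : σ ∈ smoothForms E M k) : ContDiff ℝ ∞ (flatPullback f σ) := by
  refine contDiff_iff_contDiffAt.2 fun u => ?_
  have he := chart_mem_atlas E (f u)
  have hu := mem_chart_source E (f u)
  have hc := contDiffAt_chart_comp hf he hu
  have hσu := (hσ _ he).contDiffAt
    ((chartAt E (f u)).open_target.mem_nhds ((chartAt E (f u)).map_source hu))
  exact (contDiffAt_compContinuousLinearMap (hσu.comp u hc)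
    (hc.fderiv_right (m := ∞) (by simp))).congr_of_eventuallyEq
      (flatPullback_eventuallyEq hf he hu σ)

lemma extDeriv_flatPullback {σ : DForm E M k} (hσ : σ ∈ smoothForms E M k) :
    extDeriv (flatPullback f σ) = flatPullback f (extD σ) := by
  funext u
  have he := chart_mem_atlas E (f u)
  have hu := mem_chart_source E (f u)
  rw [(flatPullback_eventuallyEq hf he hu σ).extDeriv_eq]
  refine (extDeriv_pullback (f := chartAt E (f u) ∘ f) (differentiableAt_chartRep hσ (f u))
    (contDiffAt_chart_comp hf he hu) two_le_infty).trans ?_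
  rw [fderiv_chart_comp hf he hu]
  rfl

end Pullback

end MorseNovikov

/-! ### The universal cover -/

namespace Inoue

open MorseNovikov

namespace InoueData

variable (D : InoueData) {k : ℕ}

lemma log_α_pos : 0 < Real.log D.α := Real.log_pos D.one_lt_α

/-- The function `α ^ y`: the imaginary part of `w` in logarithmic coordinates. -/
def growth (v : ℂ × ℂ) : ℝ := Real.exp (height v * Real.log D.α)

lemma growth_pos (v : ℂ × ℂ) : 0 < D.growth v := Real.exp_pos _

lemma contDiff_growth : ContDiff ℝ ∞ D.growth :=
  (height.contDiff.mul contDiff_const).exp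

/-- The coordinates `(z, x + i y) ↦ (z, x + i α ^ y)` on `ℂ × ℍ`, defined on all of `ℂ × ℂ`. -/
def expCoord (v : ℂ × ℂ) : ℂ × ℂ :=
  (v.1, (v.2.re : ℂ) + (D.growth v : ℂ) * Complex.I)

/-- The inverse coordinates `(z, w) ↦ (z, Re w + i log_α (Im w))`. -/
def logCoord (v : ℂ × ℂ) : ℂ × ℂ :=
  (v.1, (v.2.re : ℂ) + (Real.log (height v) / Real.log D.α : ℝ) * Complex.I)

lemma height_expCoord (v : ℂ × ℂ) : height (D.expCoord v) = D.growth v := by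
  simp [expCoord, height_apply]

lemma expCoord_snd_re (v : ℂ × ℂ) : (D.expCoord v).2.re = v.2.re := by
  simp [expCoord]

lemma height_logCoord (v : ℂ × ℂ) :
    height (D.logCoord v) = Real.log (height v) / Real.log D.α := by
  simp [logCoord, height_apply]

lemma logCoord_snd_re (v : ℂ × ℂ) : (D.logCoord v).2.re = v.2.re := by
  simp [logCoord]

lemma logCoord_expCoord (v : ℂ × ℂ) : D.logCoord (D.expCoord v) = v := by
  refine Prod.ext rfl (Complex.ext ?_ ?_)
  · rw [logCoord_snd_re, expCoord_snd_re]
  · rw [← height_apply, height_logCoord, height_expCoord, growth, Real.log_exp,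
      mul_div_cancel_right₀ _ D.log_α_pos.ne', height_apply]

lemma expCoord_logCoord {v : ℂ × ℂ} (hv : 0 < height v) : D.expCoord (D.logCoord v) = v := by
  refine Prod.ext rfl (Complex.ext ?_ ?_)
  · rw [expCoord_snd_re, logCoord_snd_re]
  · rw [← height_apply, height_expCoord, growth, height_logCoord,
      div_mul_cancel₀ _ D.log_α_pos.ne', Real.exp_log hv, height_apply]

lemma contDiff_expCoord : ContDiff ℝ ∞ D.expCoord :=
  contDiff_fst.prodMk ((Complex.ofRealCLM.contDiff.comp
    (Complex.reCLM.contDiff.comp contDiff_snd)).add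
      ((Complex.ofRealCLM.contDiff.comp D.contDiff_growth).mul contDiff_const))

lemma contDiffAt_logCoord {v : ℂ × ℂ} (hv : 0 < height v) : ContDiffAt ℝ ∞ D.logCoord v :=
  contDiffAt_fst.prodMk ((Complex.ofRealCLM.contDiff.comp
    (Complex.reCLM.contDiff.comp contDiff_snd)).contDiffAt.add
      ((Complex.ofRealCLM.contDiff.contDiffAt.comp v
        ((height.contDiff.contDiffAt.log hv.ne').div_const _)).mul contDiffAt_const))

/-- The diffeomorphism from the universal cover `ℂ × ℂ` onto `ℂ × ℍ`. -/
def toCH (v : ℂ × ℂ) : CH :=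
  ⟨D.expCoord v, (D.growth_pos v).trans_eq (D.height_expCoord v).symm⟩

lemma continuous_toCH : Continuous D.toCH :=
  D.contDiff_expCoord.continuous.subtype_mk _

lemma toCH_injective : Function.Injective D.toCH :=
  (show Function.LeftInverse (fun q : CH => D.logCoord q.1) D.toCH from
    D.logCoord_expCoord).injective

lemma toCH_logCoord (q : CH) : D.toCH (D.logCoord q.1) = q :=
  Subtype.ext (D.expCoord_logCoord q.2)

/-- The universal covering map `ℂ × ℂ → S⁰`, in logarithmic coordinates. -/
def cover (v : ℂ × ℂ) : D.S0 := D.proj (D.toCH v)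

lemma continuous_cover : Continuous D.cover :=
  D.isLocalHomeomorph_proj.continuous.comp D.continuous_toCH

/-- The element `(z, w) ↦ (β ^ n z + ∑ mᵢ bᵢ, α ^ n w + ∑ mᵢ aᵢ)` of `G_A`, read in logarithmic
coordinates. -/
def deck (n : ℤ) (m : Fin 3 → ℤ) (v : ℂ × ℂ) : ℂ × ℂ :=
  D.deckMap n v + D.lattice fun i => (m i : ℝ)

lemma contDiff_deck (n : ℤ) (m : Fin 3 → ℤ) : ContDiff ℝ ∞ (D.deck n m) :=
  (D.contDiff_deckMap n).add contDiff_const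

lemma hasFDerivAt_deck (n : ℤ) (m : Fin 3 → ℤ) (v : ℂ × ℂ) :
    HasFDerivAt (D.deck n m) (D.deckLinear n) v :=
  ((D.deckLinear n).hasFDerivAt.add_const _).add_const _

lemma growth_deck (n : ℤ) (m : Fin 3 → ℤ) (v : ℂ × ℂ) :
    D.growth (D.deck n m v) = D.α ^ n * D.growth v := by
  have hexp : D.α ^ n = Real.exp (n * Real.log D.α) := by
    rw [mul_comm, ← Real.rpow_def_of_pos D.α_pos, Real.rpow_intCast]
  rw [growth, growth, deck, map_add, height_lattice, height_deckMap, add_zero, hexp,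
    ← Real.exp_add, add_mul, add_comm]

lemma toCH_deck {g : Equiv.Perm CH} {n : ℤ} {m : Fin 3 → ℤ} (h : D.Describes g n m)
    (v : ℂ × ℂ) : D.toCH (D.deck n m v) = g (D.toCH v) := by
  refine Subtype.ext (Prod.ext ?_ (Complex.ext ?_ ?_))
  · rw [h]
    simp [toCH, expCoord, deck, deckMap, deckLinear_fst, lattice_apply, vertical]
  · rw [h]
    change (D.expCoord _).2.re = (((D.α ^ n : ℝ) : ℂ) * (D.expCoord v).2 + _).re
    rw [expCoord_snd_re, Complex.add_re, Complex.re_ofReal_mul, expCoord_snd_re,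
      Complex.ofReal_re, deck, Prod.snd_add, Complex.add_re, lattice_apply, Complex.ofReal_re,
      deckMap, Prod.snd_add, Complex.add_re, deckLinear_re]
    simp [vertical]
  · rw [h.im]
    change height (D.expCoord _) = D.α ^ n * height (D.expCoord v)
    rw [height_expCoord, height_expCoord, growth_deck]

lemma smul_proj (g : D.G) (q : CH) : D.proj (g • q) = D.proj q :=
  Quotient.sound ⟨g, rfl⟩

lemma cover_deck {g : Equiv.Perm CH} (hg : g ∈ D.G) {n : ℤ} {m : Fin 3 → ℤ}
    (h : D.Describes g n m) (v : ℂ × ℂ) : D.cover (D.deck n m v) = D.cover v := by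
  rw [cover, D.toCH_deck h]
  exact D.smul_proj ⟨g, hg⟩ _

lemma exists_deck_of_cover_eq {u u' : ℂ × ℂ} (h : D.cover u' = D.cover u) :
    ∃ n m, D.deck n m u = u' ∧ ∀ v, D.cover (D.deck n m v) = D.cover v := by
  obtain ⟨g, hg⟩ : ∃ g : D.G, g • D.toCH u = D.toCH u' := Quotient.exact h
  obtain ⟨n, m, hd⟩ := D.exists_describes g.2
  exact ⟨n, m, D.toCH_injective ((D.toCH_deck hd u).trans hg), D.cover_deck g.2 hd⟩

lemma exists_describes_translation (m : Fin 3 → ℤ) : ∃ g ∈ D.G, D.Describes g 0 m := by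
  let H : AddSubgroup (Fin 3 → ℤ) :=
    { carrier := {m | ∃ g ∈ D.G, D.Describes g 0 m}
      zero_mem' := ⟨1, one_mem _, Describes.one D⟩
      add_mem' := by
        rintro m m' ⟨g, hg, h⟩ ⟨g', hg', h'⟩
        exact ⟨g' * g, mul_mem hg' hg, by simpa using h'.mul h⟩
      neg_mem' := by
        rintro m ⟨g, hg, h⟩
        exact ⟨g⁻¹, inv_mem hg, by simpa using h.inv⟩ }
  have hsingle (i : Fin 3) : Pi.single i (1 : ℤ) ∈ H :=
    ⟨D.translation i, Subgroup.subset_closure (Or.inr ⟨i, rfl⟩), fun q => by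
      simp [translation, Pi.single_apply, apply_ite (Int.cast : ℤ → ℂ),
        apply_ite (Int.cast : ℤ → ℝ)]⟩
  have hsum : ∑ i, m i • (Pi.single i (1 : ℤ) : Fin 3 → ℤ) ∈ H :=
    sum_mem fun i _ => H.zsmul_mem (hsingle i) _
  rwa [← pi_eq_sum_univ' m] at hsum

lemma cover_deck_zero (m : Fin 3 → ℤ) (v : ℂ × ℂ) : D.cover (D.deck 0 m v) = D.cover v := by
  obtain ⟨g, hg, h⟩ := D.exists_describes_translation m
  exact D.cover_deck hg h v

lemma cover_deck_one (v : ℂ × ℂ) : D.cover (D.deck 1 0 v) = D.cover v :=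
  D.cover_deck (g := D.dilation) (Subgroup.subset_closure (Or.inl rfl))
    (fun q => by simp [dilation]) v

lemma eventually_cover_mem_source {e : OpenPartialHomeomorph D.S0 (ℂ × ℂ)} {u : ℂ × ℂ}
    (hu : D.cover u ∈ e.source) : ∀ᶠ v in 𝓝 u, D.cover v ∈ e.source :=
  D.continuous_cover.continuousAt.preimage_mem_nhds (e.open_source.mem_nhds hu)

section Charts

variable {D} {e : OpenPartialHomeomorph D.S0 (ℂ × ℂ)} (he : e ∈ atlas (ℂ × ℂ) D.S0)

include he

lemma exists_coe_eq_and_symm_eq_proj {y : ℂ × ℂ} (hy : y ∈ e.target) :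
    ∃ q : CH, (q : ℂ × ℂ) = y ∧ e.symm y = D.proj q := by
  obtain ⟨q, rfl⟩ := D.exists_of_mem_atlas he
  simp only [mfld_simps] at hy
  exact ⟨(chartAt (ℂ × ℂ) q).symm y, (chartAt (ℂ × ℂ) q).right_inv hy.1,
    congrFun (D.isLocalHomeomorph_proj.localInverseAt_symm q) _⟩

lemma height_pos_of_mem_target {y : ℂ × ℂ} (hy : y ∈ e.target) : 0 < height y := by
  obtain ⟨q, rfl, -⟩ := exists_coe_eq_and_symm_eq_proj he hy
  exact q.2

lemma symm_eq_cover_logCoord {y : ℂ × ℂ} (hy : y ∈ e.target) :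
    e.symm y = D.cover (D.logCoord y) := by
  obtain ⟨q, rfl, hq⟩ := exists_coe_eq_and_symm_eq_proj he hy
  rw [hq, cover, toCH_logCoord]

lemma continuousAt_logCoord_comp {u : ℂ × ℂ} (hu : D.cover u ∈ e.source) :
    ContinuousAt (fun v => D.logCoord (e (D.cover v))) u :=
  ContinuousAt.comp (f := fun v => e (D.cover v))
    (D.contDiffAt_logCoord (height_pos_of_mem_target he (e.map_source hu))).continuousAt
    (ContinuousAt.comp (e.continuousAt hu) D.continuous_cover.continuousAt)

lemma eventually_logCoord_eq_deck {u : ℂ × ℂ} (hu : D.cover u ∈ e.source) :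
    ∃ n m, ∀ᶠ v in 𝓝 u, D.logCoord (e (D.cover v)) = D.deck n m v := by
  have hcov {v : ℂ × ℂ} (hv : D.cover v ∈ e.source) :
      D.cover (D.logCoord (e (D.cover v))) = D.cover v := by
    rw [← symm_eq_cover_logCoord he (e.map_source hv), e.left_inv hv]
  obtain ⟨n, m, hdeck, hinv⟩ := D.exists_deck_of_cover_eq (hcov hu)
  obtain ⟨U, hU, hmem, hinj⟩ :=
    D.isLocalHomeomorph_proj.isLocallyInjective (D.toCH (D.deck n m u))
  have hdeckU : ∀ᶠ v in 𝓝 u, D.toCH (D.deck n m v) ∈ U :=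
    (D.continuous_toCH.comp (D.contDiff_deck n m).continuous).continuousAt.preimage_mem_nhds
      (hU.mem_nhds hmem)
  have hchartU : ∀ᶠ v in 𝓝 u, D.toCH (D.logCoord (e (D.cover v))) ∈ U :=
    (D.continuous_toCH.continuousAt.comp (continuousAt_logCoord_comp he hu)).preimage_mem_nhds
      (hU.mem_nhds (by rwa [Function.comp_apply, ← hdeck]))
  refine ⟨n, m, ?_⟩
  filter_upwards [D.eventually_cover_mem_source hu, hdeckU, hchartU] with v hv hv₁ hv₂
  exact D.toCH_injective (hinj hv₂ hv₁ ((hcov hv).trans (hinv v).symm))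

end Charts

variable {D}

lemma contMDiff_cover : ContMDiff 𝓘(ℝ, ℂ × ℂ) 𝓘(ℝ, ℂ × ℂ) ∞ D.cover := by
  intro u
  have he := chart_mem_atlas (ℂ × ℂ) (D.cover u)
  have hu := mem_chart_source (ℂ × ℂ) (D.cover u)
  set e := chartAt (ℂ × ℂ) (D.cover u)
  obtain ⟨n, m, hdeck⟩ := eventually_logCoord_eq_deck he hu
  have hsource := D.eventually_cover_mem_source hu
  have hexp : ∀ᶠ v in 𝓝 u, D.expCoord (D.deck n m v) = e (D.cover v) := by
    filter_upwards [hsource, hdeck] with v hv hv'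
    rw [← hv', D.expCoord_logCoord (height_pos_of_mem_target he (e.map_source hv))]
  have hsymm : ContMDiffAt 𝓘(ℝ, ℂ × ℂ) 𝓘(ℝ, ℂ × ℂ) ∞ e.symm (D.expCoord (D.deck n m u)) :=
    contMDiffAt_symm_of_mem_maximalAtlas (IsManifold.subset_maximalAtlas he)
      (by rw [hexp.self_of_nhds]; exact e.map_source hu)
  refine (ContMDiffAt.comp (f := D.expCoord ∘ D.deck n m) u hsymm
    (D.contDiff_expCoord.comp (D.contDiff_deck n m)).contMDiff.contMDiffAt).congr_of_eventuallyEq ?_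
  filter_upwards [hsource, hexp] with v hv hv'
  rw [Function.comp_apply, Function.comp_apply, hv', e.left_inv hv]

lemma mdifferentiable_cover : MDifferentiable 𝓘(ℝ, ℂ × ℂ) 𝓘(ℝ, ℂ × ℂ) D.cover :=
  contMDiff_cover.mdifferentiable (by simp)

lemma chartRep_eq_flatPullback_comp_fderiv (σ : DForm (ℂ × ℂ) D.S0 k)
    {e : OpenPartialHomeomorph D.S0 (ℂ × ℂ)} (he : e ∈ atlas (ℂ × ℂ) D.S0) {y : ℂ × ℂ}
    (hy : y ∈ e.target) :
    chartRep e σ y = (flatPullback D.cover σ (D.logCoord y)).compContinuousLinearMap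
      (fderiv ℝ D.logCoord y) := by
  have hlog := (D.contDiffAt_logCoord (height_pos_of_mem_target he hy)).differentiableAt (by simp)
  refine flatPullback_eq_of_eventuallyEq_comp (mdifferentiable_cover _) hlog.hasFDerivAt ?_ σ
  filter_upwards [e.open_target.mem_nhds hy] with v hv using symm_eq_cover_logCoord he hv

lemma flatPullback_cover_injective :
    Function.Injective (flatPullback D.cover : DForm (ℂ × ℂ) D.S0 k → CoverForm k) := by
  intro σ σ' h
  funext x
  have he := chart_mem_atlas (ℂ × ℂ) x
  have hx := mem_chart_source (ℂ × ℂ) x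
  have hy := (chartAt (ℂ × ℂ) x).map_source hx
  rw [eq_chartRep_comp_mfderiv σ he hx, eq_chartRep_comp_mfderiv σ' he hx,
    chartRep_eq_flatPullback_comp_fderiv σ he hy, chartRep_eq_flatPullback_comp_fderiv σ' he hy, h]

lemma mem_smoothForms_of_contDiff {σ : DForm (ℂ × ℂ) D.S0 k}
    (h : ContDiff ℝ ∞ (flatPullback D.cover σ)) : σ ∈ smoothForms (ℂ × ℂ) D.S0 k := by
  intro e he y hy
  have hlog := D.contDiffAt_logCoord (height_pos_of_mem_target he hy)
  refine ContDiffAt.contDiffWithinAt (ContDiffAt.congr_of_eventuallyEq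
    (contDiffAt_compContinuousLinearMap (h.contDiffAt.comp y hlog)
      (hlog.fderiv_right (m := ∞) (by simp))) ?_)
  filter_upwards [e.open_target.mem_nhds hy] with v hv
    using chartRep_eq_flatPullback_comp_fderiv σ he hv

lemma flatPullback_comp_deckLinear (σ : DForm (ℂ × ℂ) D.S0 k) {n : ℤ} {m : Fin 3 → ℤ}
    (h : ∀ v, D.cover (D.deck n m v) = D.cover v) (x : ℂ × ℂ) :
    (flatPullback D.cover σ (D.deck n m x)).compContinuousLinearMap (D.deckLinear n) =
      flatPullback D.cover σ x :=
  (flatPullback_eq_of_eventuallyEq_comp (mdifferentiable_cover _) (D.hasFDerivAt_deck n m x)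
    (.of_forall fun v => (h v).symm) σ).symm

lemma exists_mfderiv_logCoord_comp_chart_eq (u : ℂ × ℂ) : ∃ n m,
    D.logCoord (chartAt (ℂ × ℂ) (D.cover u) (D.cover u)) = D.deck n m u ∧
      ∀ w : ℂ × ℂ, mfderiv 𝓘(ℝ, ℂ × ℂ) 𝓘(ℝ, ℂ × ℂ)
        (D.logCoord ∘ chartAt (ℂ × ℂ) (D.cover u)) (D.cover u)
        (mfderiv 𝓘(ℝ, ℂ × ℂ) 𝓘(ℝ, ℂ × ℂ) D.cover u w) = D.deckLinear n w := by
  have he := chart_mem_atlas (ℂ × ℂ) (D.cover u)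
  have hu := mem_chart_source (ℂ × ℂ) (D.cover u)
  obtain ⟨n, m, hdeck⟩ := eventually_logCoord_eq_deck he hu
  have hlog := D.contDiffAt_logCoord
    (height_pos_of_mem_target he ((chartAt (ℂ × ℂ) (D.cover u)).map_source hu))
  have hsection : MDifferentiableAt 𝓘(ℝ, ℂ × ℂ) 𝓘(ℝ, ℂ × ℂ)
      (D.logCoord ∘ chartAt (ℂ × ℂ) (D.cover u)) (D.cover u) :=
    MDifferentiableAt.comp _ (hlog.differentiableAt (by simp)).mdifferentiableAt
      (mdifferentiableAt_atlas he hu)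
  have hcomp := mfderiv_comp u hsection (mdifferentiable_cover u)
  have hderiv : mfderiv 𝓘(ℝ, ℂ × ℂ) 𝓘(ℝ, ℂ × ℂ)
      ((D.logCoord ∘ chartAt (ℂ × ℂ) (D.cover u)) ∘ D.cover) u = D.deckLinear n := by
    rw [mfderiv_eq_fderiv]
    exact ((D.hasFDerivAt_deck n m u).congr_of_eventuallyEq hdeck).fderiv
  exact ⟨n, m, hdeck.self_of_nhds, fun w => congrArg (fun L => L w) (hcomp.symm.trans hderiv)⟩

lemma exists_flatPullback_eq {τ : CoverForm k}
    (h : ∀ n m x, (τ (D.deck n m x)).compContinuousLinearMap (D.deckLinear n) = τ x) :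
    ∃ σ : DForm (ℂ × ℂ) D.S0 k, flatPullback D.cover σ = τ := by
  let s (x : D.S0) : D.S0 → ℂ × ℂ := D.logCoord ∘ chartAt (ℂ × ℂ) x
  let σ : DForm (ℂ × ℂ) D.S0 k := fun x =>
    ContinuousAlternatingMap.compContinuousLinearMap (τ (s x x))
      (mfderiv 𝓘(ℝ, ℂ × ℂ) 𝓘(ℝ, ℂ × ℂ) (s x) x)
  refine ⟨σ, funext fun u => ?_⟩
  obtain ⟨n, m, hs, hderiv⟩ := exists_mfderiv_logCoord_comp_chart_eq (D := D) u
  rw [← h n m u]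
  ext v
  change τ (D.logCoord (chartAt (ℂ × ℂ) (D.cover u) (D.cover u))) (fun i =>
    mfderiv 𝓘(ℝ, ℂ × ℂ) 𝓘(ℝ, ℂ × ℂ) (D.logCoord ∘ chartAt (ℂ × ℂ) (D.cover u)) (D.cover u)
      (mfderiv 𝓘(ℝ, ℂ × ℂ) 𝓘(ℝ, ℂ × ℂ) D.cover u (v i))) = _
  simp only [hderiv, hs]
  rfl

end InoueData

end Inoue

/-! ### Morse–Novikov cohomology -/

namespace MorseNovikov

section Wedge

variable {E : Type*} [NormedAddCommGroup E] [NormedSpace ℝ E] {k : ℕ}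

lemma wedgeAt_compContinuousLinearMap {E' : Type*} [NormedAddCommGroup E'] [NormedSpace ℝ E']
    (η : E [⋀^Fin 1]→L[ℝ] ℝ) (σ : E [⋀^Fin k]→L[ℝ] ℝ) (L : E' →L[ℝ] E) :
    (wedgeAt η σ).compContinuousLinearMap L =
      wedgeAt (η.compContinuousLinearMap L) (σ.compContinuousLinearMap L) := by
  ext v
  simp only [wedgeAt, ContinuousAlternatingMap.compContinuousLinearMap_apply,
    ContinuousAlternatingMap.alternatizeUncurryFin_apply]
  rfl

lemma flatPullback_wedgeOne {E' : Type*} [NormedAddCommGroup E'] [NormedSpace ℝ E']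
    {M : Type*} [TopologicalSpace M] [ChartedSpace E M] (f : E' → M) (η : DForm E M 1)
    (σ : DForm E M k) (x : E') :
    flatPullback f (wedgeOne η σ) x = wedgeAt (flatPullback f η x) (flatPullback f σ x) :=
  wedgeAt_compContinuousLinearMap (E := E) (E' := E') (η (f x)) (σ (f x))
    (mfderiv 𝓘(ℝ, E') 𝓘(ℝ, E) f x)

lemma wedgeAt_smul_left (c : ℝ) (η : E [⋀^Fin 1]→L[ℝ] ℝ) (σ : E [⋀^Fin k]→L[ℝ] ℝ) :
    wedgeAt (c • η) σ = c • wedgeAt η σ := by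
  rw [wedgeAt, wedgeAt, ← ContinuousAlternatingMap.alternatizeUncurryFin_smul]
  congr 1
  ext v w
  exact mul_assoc _ _ _

end Wedge

lemma nonempty_quotient_submoduleOf_equiv {K V : Type*} [Field K] [AddCommGroup V] [Module K V]
    {Z B : Submodule K V} {c : V} (hc : c ∈ Z) (hc' : c ∉ B)
    (h : ∀ z ∈ Z, ∃ r : K, z - r • c ∈ B) : Nonempty ((Z ⧸ B.submoduleOf Z) ≃ₗ[K] K) := by
  let q : Z ⧸ B.submoduleOf Z := Submodule.Quotient.mk ⟨c, hc⟩
  have hq : q ≠ 0 := fun h => hc' ((Submodule.Quotient.mk_eq_zero (B.submoduleOf Z)).1 h)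
  refine ⟨(LinearEquiv.ofBijective (LinearMap.toSpanSingleton K _ q)
    ⟨smul_left_injective K hq, fun w => ?_⟩).symm⟩
  obtain ⟨z, rfl⟩ := Submodule.Quotient.mk_surjective _ w
  obtain ⟨r, hr⟩ := h z.1 z.2
  refine ⟨r, ?_⟩
  rw [LinearMap.toSpanSingleton_apply, ← Submodule.Quotient.mk_smul, eq_comm,
    Submodule.Quotient.eq]
  exact hr

end MorseNovikov

namespace Inoue

open MorseNovikov

/-- The linear form `dy` on the cover, as an alternating form of degree one. -/
def dy : (ℂ × ℂ) [⋀^Fin 1]→L[ℝ] ℝ :=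
  ContinuousAlternatingMap.ofSubsingleton ℝ (ℂ × ℂ) ℝ (0 : Fin 1) height

namespace InoueData

variable {D : InoueData} {k : ℕ}

lemma contDiff_growth_inv : ContDiff ℝ ∞ fun v => (D.growth v)⁻¹ :=
  D.contDiff_growth.inv fun v => (D.growth_pos v).ne'

lemma hasFDerivAt_growth_inv (v : ℂ × ℂ) :
    HasFDerivAt (fun v => (D.growth v)⁻¹) ((D.growth v)⁻¹ • (-Real.log D.α) • height) v := by
  simp only [growth, ← Real.exp_neg, ← mul_neg]
  exact (height.hasFDerivAt.mul_const (-Real.log D.α)).exp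

variable (D) in
/-- The lift of a form to the universal cover, divided by `α ^ y`; this turns the twisted
differential of the Lee form into the exterior derivative. -/
def untwist (σ : DForm (ℂ × ℂ) D.S0 k) : CoverForm k :=
  fun v => (D.growth v)⁻¹ • flatPullback D.cover σ v

lemma untwist_sub_smul (σ σ' : DForm (ℂ × ℂ) D.S0 k) (r : ℝ) :
    D.untwist (σ - r • σ') = D.untwist σ - r • D.untwist σ' := by
  funext v
  ext _
  exact (mul_sub _ _ _).trans (congrArg _ (mul_left_comm _ _ _))

lemma untwist_zero : D.untwist (0 : DForm (ℂ × ℂ) D.S0 k) = 0 := by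
  funext v
  ext _
  exact mul_zero _

lemma untwist_injective :
    Function.Injective (D.untwist : DForm (ℂ × ℂ) D.S0 k → CoverForm k) := fun _ _ h =>
  flatPullback_cover_injective (funext fun v =>
    smul_right_injective _ (inv_ne_zero (D.growth_pos v).ne') (congrFun h v))

lemma untwist_comp_deckLinear (σ : DForm (ℂ × ℂ) D.S0 k) {n : ℤ} {m : Fin 3 → ℤ}
    (h : ∀ v, D.cover (D.deck n m v) = D.cover v) (x : ℂ × ℂ) :
    D.α ^ n • (D.untwist σ (D.deck n m x)).compContinuousLinearMap (D.deckLinear n) =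
      D.untwist σ x := by
  rw [untwist, untwist, ← flatPullback_comp_deckLinear σ h x, growth_deck, mul_inv, mul_smul]
  ext w
  exact mul_inv_cancel_left₀ (zpow_pos D.α_pos n).ne' _

lemma untwist_mem_invariantForms {σ : DForm (ℂ × ℂ) D.S0 k}
    (hσ : σ ∈ smoothForms (ℂ × ℂ) D.S0 k) : D.untwist σ ∈ D.invariantForms k := by
  refine mem_invariantForms.2
    ⟨⟨contDiff_growth_inv.smul (contDiff_flatPullback contMDiff_cover hσ), fun m x => ?_⟩,
      funext fun x => ?_⟩
  · have hlinear : D.deckLinear 0 = ContinuousLinearMap.id ℝ (ℂ × ℂ) :=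
      ContinuousLinearMap.ext D.deckLinear_zero
    have hdeck : D.deck 0 m x = x + D.lattice fun i => (m i : ℝ) := by
      simp [deck, deckMap, hlinear]
    have hinv := untwist_comp_deckLinear σ (D.cover_deck_zero m) x
    rwa [zpow_zero, one_smul, hlinear, hdeck] at hinv
  · have hdeck : D.deck 1 0 x = D.deckMap 1 x := by
      simp only [deck, Pi.zero_apply, Int.cast_zero]
      exact (congrArg (D.deckMap 1 x + ·) (map_zero D.lattice)).trans (add_zero _)
    rw [twistedPullback_apply, ← hdeck, untwist_comp_deckLinear σ D.cover_deck_one]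

lemma twistedPullback_eq_of_mem_invariantForms {τ : CoverForm k} (h : τ ∈ D.invariantForms k)
    (n : ℤ) : D.twistedPullback n τ = τ := by
  have hone := (mem_invariantForms.1 h).2
  induction n using Int.induction_on with
  | zero => exact D.twistedPullback_zero τ
  | succ n ih => rw [← twistedPullback_twistedPullback, hone, ih]
  | pred n ih => rw [← hone, twistedPullback_twistedPullback, sub_add_cancel, hone, ih]

lemma exists_untwist_eq {τ : CoverForm k} (h : τ ∈ D.invariantForms k) :
    ∃ σ ∈ smoothForms (ℂ × ℂ) D.S0 k, D.untwist σ = τ := by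
  have hperiodic := (mem_invariantForms.1 h).1
  have hinv (n : ℤ) (m : Fin 3 → ℤ) (x : ℂ × ℂ) :
      (D.growth (D.deck n m x) • τ (D.deck n m x)).compContinuousLinearMap (D.deckLinear n) =
        D.growth x • τ x := by
    rw [← congrFun (twistedPullback_eq_of_mem_invariantForms h n) x, twistedPullback_apply,
      growth_deck, deck, hperiodic.2, smul_smul, mul_comm]
    rfl
  obtain ⟨σ, hσ⟩ := exists_flatPullback_eq (D := D) (τ := fun x => D.growth x • τ x) hinv
  refine ⟨σ, mem_smoothForms_of_contDiff ?_, funext fun x => ?_⟩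
  · rw [hσ]
    exact D.contDiff_growth.smul hperiodic.1
  · rw [untwist, hσ, inv_smul_smul₀ (D.growth_pos x).ne']

section Cohomology

variable {θ : DForm (ℂ × ℂ) D.S0 1}
  (hθ : flatPullback D.cover θ = fun _ => Real.log D.α • dy)

include hθ

lemma untwist_twistedD (σ : smoothForms (ℂ × ℂ) D.S0 k) :
    D.untwist (twistedD θ k σ) = extDeriv (D.untwist σ.1) := by
  funext x
  have hσ := (contDiff_flatPullback contMDiff_cover σ.2).differentiable (by simp) x
  have hgrowth := hasFDerivAt_growth_inv (D := D) x
  have hdy : ContinuousAlternatingMap.ofSubsingleton ℝ (ℂ × ℂ) ℝ (0 : Fin 1)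
      ((D.growth x)⁻¹ • (-Real.log D.α) • height) = (D.growth x)⁻¹ • (-Real.log D.α) • dy := rfl
  have hleft : D.untwist (twistedD θ k σ) x = (D.growth x)⁻¹ •
      (flatPullback D.cover (extD σ.1) x - flatPullback D.cover (wedgeOne θ σ.1) x) := rfl
  have hright : extDeriv (D.untwist σ.1) x = _ := extDeriv_smul_fun hgrowth.differentiableAt hσ
  rw [hleft, hright, hgrowth.fderiv, hdy, extDeriv_flatPullback contMDiff_cover σ.2,
    flatPullback_wedgeOne, hθ, wedgeAt_smul_left, wedgeAt_smul_left, wedgeAt_smul_left]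
  generalize wedgeAt dy (flatPullback D.cover σ.1 x) = ξ
  ext v
  change (D.growth x)⁻¹ * (_ - Real.log D.α * ξ v) =
    (D.growth x)⁻¹ * _ + (D.growth x)⁻¹ * (-Real.log D.α * ξ v)
  ring

lemma mem_cocycles_iff {σ : smoothForms (ℂ × ℂ) D.S0 k} :
    σ ∈ cocycles θ k ↔ extDeriv (D.untwist σ.1) = 0 := by
  rw [← untwist_twistedD hθ]
  exact ⟨fun h => (congrArg D.untwist h).trans untwist_zero,
    fun h => LinearMap.mem_ker.2 (untwist_injective (h.trans untwist_zero.symm))⟩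

lemma mem_coboundaries_iff {σ : smoothForms (ℂ × ℂ) D.S0 (k + 1)} :
    σ ∈ coboundaries θ (k + 1) ↔ ∃ ρ ∈ D.invariantForms k, extDeriv ρ = D.untwist σ.1 := by
  constructor
  · rintro ⟨ρ, hρ⟩
    exact ⟨D.untwist ρ.1, untwist_mem_invariantForms ρ.2,
      (untwist_twistedD hθ ρ).symm.trans (congrArg D.untwist hρ)⟩
  · rintro ⟨_, hinv, hσ⟩
    obtain ⟨ρ, hρ, rfl⟩ := exists_untwist_eq hinv
    exact ⟨⟨ρ, hρ⟩, untwist_injective ((untwist_twistedD hθ ⟨ρ, hρ⟩).trans hσ)⟩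

lemma nonempty_cohomology_equiv {τ₀ : CoverForm (k + 1)} (h₀ : τ₀ ∈ D.invariantForms (k + 1))
    (hclosed : extDeriv τ₀ = 0) (hne : ∀ ρ ∈ D.invariantForms k, extDeriv ρ ≠ τ₀)
    (hgen : ∀ τ ∈ D.invariantForms (k + 1), extDeriv τ = 0 →
      ∃ r : ℝ, ∃ ρ ∈ D.invariantForms k, τ = r • τ₀ + extDeriv ρ) :
    Nonempty (Cohomology θ (k + 1) ≃ₗ[ℝ] ℝ) := by
  obtain ⟨σ₀, hσ₀, rfl⟩ := exists_untwist_eq h₀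
  refine nonempty_quotient_submoduleOf_equiv (c := ⟨σ₀, hσ₀⟩) ((mem_cocycles_iff hθ).2 hclosed)
    (fun h => ?_) fun σ hσ => ?_
  · obtain ⟨ρ, hρ, hρσ⟩ := (mem_coboundaries_iff hθ).1 h
    exact hne ρ hρ hρσ
  · obtain ⟨r, ρ, hρ, hσρ⟩ :=
      hgen _ (untwist_mem_invariantForms σ.2) ((mem_cocycles_iff hθ).1 hσ)
    refine ⟨r, (mem_coboundaries_iff hθ).2 ⟨ρ, hρ, ?_⟩⟩
    refine Eq.trans ?_ (untwist_sub_smul σ.1 σ₀ r).symm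
    rw [hσρ, add_sub_cancel_left]

theorem subsingleton_cohomology (h2 : k ≠ 2) (h3 : k ≠ 3) : Subsingleton (Cohomology θ k) := by
  rw [Submodule.Quotient.subsingleton_iff, Submodule.eq_top_iff']
  rintro ⟨σ, hσ⟩
  have hinv := untwist_mem_invariantForms σ.2
  have hclosed := (mem_cocycles_iff hθ).1 hσ
  cases k with
  | zero =>
    have hzero : σ.1 = 0 :=
      untwist_injective ((eq_zero_of_extDeriv_eq_zero hinv hclosed).trans untwist_zero.symm)
    exact Subtype.ext hzero
  | succ k => exact (mem_coboundaries_iff hθ).2 (exists_primitive h2 h3 hinv hclosed)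

theorem nonempty_cohomology_two_equiv : Nonempty (Cohomology θ 2 ≃ₗ[ℝ] ℝ) :=
  nonempty_cohomology_equiv hθ areaForm_mem_invariantForms (extDeriv_const _)
    (fun _ hρ => extDeriv_ne_areaForm hρ.1) fun _ => exists_eq_smul_areaForm_add

theorem nonempty_cohomology_three_equiv : Nonempty (Cohomology θ 3 ≃ₗ[ℝ] ℝ) :=
  nonempty_cohomology_equiv hθ extDeriv_heightArea_mem_invariantForms
    (extDeriv_extDeriv (heightArea_mem_periodicForms (D := D)).1 two_le_infty)
    (fun _ => extDeriv_ne_extDeriv_heightArea)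
    fun _ => exists_eq_smul_extDeriv_heightArea_add_of_mem_invariantForms

end Cohomology

end InoueData

end Inoue

/-! ### The Lee form -/

namespace Inoue

open MorseNovikov

lemma pullback_circleForm_circleExp {E : Type*} [NormedAddCommGroup E] [NormedSpace ℝ E]
    {M : Type*} [TopologicalSpace M] [ChartedSpace E M] {f : M → ℝ}
    (hf : MDifferentiable 𝓘(ℝ, E) 𝓘(ℝ, ℝ) f) :
    pullback (fun x => Circle.exp (2 * Real.pi * f x)) circleForm =
      oneForm fun x => mfderiv 𝓘(ℝ, E) 𝓘(ℝ, ℝ) f x := by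
  have := finrank_real_complex_fact'
  funext x
  set z := Circle.exp (2 * Real.pi * f x) with hz
  have hcoe : MDifferentiableAt (𝓡 1) 𝓘(ℝ, ℂ) (fun z : Circle => (z : ℂ)) z :=
    (contMDiff_coe_sphere (E := ℂ) (n := 1) (m := ∞)).contMDiffAt.mdifferentiableAt (by simp)
  have hexp : MDifferentiableAt 𝓘(ℝ, E) (𝓡 1) (fun x => Circle.exp (2 * Real.pi * f x)) x :=
    MDifferentiableAt.comp x
      ((contMDiff_circleExp (m := ∞)).contMDiffAt.mdifferentiableAt (by simp))
      (MDifferentiableAt.comp (g := fun t => 2 * Real.pi * t) x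
        (differentiableAt_id.const_mul _).mdifferentiableAt (hf x))
  have hderiv : HasFDerivAt (fun t : ℝ => (Circle.exp (2 * Real.pi * t) : ℂ))
      (ContinuousLinearMap.toSpanSingleton ℝ (z * ((2 * Real.pi : ℝ) * Complex.I))) (f x) := by
    simp only [hz, Circle.coe_exp]
    exact ((((hasDerivAt_id (f x)).const_mul (2 * Real.pi)).ofReal_comp.mul_const
      Complex.I).cexp.congr_deriv (by simp)).hasFDerivAt
  have hcomp := (mfderiv_comp x hcoe hexp).symm.trans
    (mfderiv_comp (f := f) x hderiv.differentiableAt.mdifferentiableAt (hf x))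
  rw [mfderiv_eq_fderiv, hderiv.fderiv] at hcomp
  ext v
  let r : ℝ := mfderiv 𝓘(ℝ, E) 𝓘(ℝ, ℝ) f x (v 0)
  let ξ : ℂ := mfderiv (𝓡 1) 𝓘(ℝ, ℂ) (fun z : Circle => (z : ℂ)) z
    (mfderiv 𝓘(ℝ, E) (𝓡 1) (fun x => Circle.exp (2 * Real.pi * f x)) x (v 0))
  have hξ : ξ = r • (z * ((2 * Real.pi : ℝ) * Complex.I) : ℂ) := congrArg (fun L => L (v 0)) hcomp
  change (2 * Real.pi)⁻¹ * (((z⁻¹ : Circle) : ℂ) * ξ).im = r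
  rw [hξ, mul_smul_comm, Circle.coe_inv, inv_mul_cancel_left₀ z.coe_ne_zero, Complex.smul_im,
    Complex.im_ofReal_mul, Complex.I_im, mul_one, smul_eq_mul, mul_comm r,
    inv_mul_cancel_left₀ Real.two_pi_pos.ne']

namespace InoueData

variable {D : InoueData} {k : ℕ}

lemma mdifferentiable_toCH : MDifferentiable 𝓘(ℝ, ℂ × ℂ) 𝓘(ℝ, ℂ × ℂ) D.toCH := fun _ =>
  (contMDiffAt_iff_target.2 ⟨D.continuous_toCH.continuousAt,
    D.contDiff_expCoord.contDiffAt.contMDiffAt⟩).mdifferentiableAt (n := ∞) (by simp)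

lemma mdifferentiable_coe_CH :
    MDifferentiable 𝓘(ℝ, ℂ × ℂ) 𝓘(ℝ, ℂ × ℂ) fun q : CH => (q : ℂ × ℂ) :=
  (contMDiff_subtype_val (n := ∞)).mdifferentiable (by simp)

lemma mdifferentiable_logCoord_coe :
    MDifferentiable 𝓘(ℝ, ℂ × ℂ) 𝓘(ℝ, ℂ × ℂ) fun q : CH => D.logCoord q := fun q =>
  MDifferentiableAt.comp q
    ((D.contDiffAt_logCoord q.2).differentiableAt (by simp)).mdifferentiableAt
    (mdifferentiable_coe_CH q)

lemma proj_eq_cover_comp_logCoord : D.proj = D.cover ∘ fun q : CH => D.logCoord q :=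
  funext fun q => (congrArg D.proj (D.toCH_logCoord q)).symm

lemma mdifferentiable_proj : MDifferentiable 𝓘(ℝ, ℂ × ℂ) 𝓘(ℝ, ℂ × ℂ) D.proj := by
  rw [proj_eq_cover_comp_logCoord]
  exact mdifferentiable_cover.comp mdifferentiable_logCoord_coe

lemma pullback_proj_injective :
    Function.Injective (pullback D.proj : DForm (ℂ × ℂ) D.S0 k → DForm (ℂ × ℂ) CH k) :=
  fun σ σ' h => flatPullback_cover_injective <|
    (pullback_comp mdifferentiable_proj mdifferentiable_toCH σ).trans <|
      (congrArg (pullback D.toCH) h).trans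
        (pullback_comp mdifferentiable_proj mdifferentiable_toCH σ').symm

lemma fibration_cover (u : ℂ × ℂ) :
    D.fibration (D.cover u) = Circle.exp (2 * Real.pi * height u) := by
  change Circle.exp (2 * Real.pi * Real.logb D.α (height (D.expCoord u))) = _
  rw [height_expCoord, growth, Real.logb, Real.log_exp, mul_div_cancel_right₀ _ D.log_α_pos.ne']

lemma mdifferentiable_fibration : MDifferentiable 𝓘(ℝ, ℂ × ℂ) (𝓡 1) D.fibration := fun x => by
  have he := chart_mem_atlas (ℂ × ℂ) x
  have hx := mem_chart_source (ℂ × ℂ) x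
  set e := chartAt (ℂ × ℂ) x
  have hheight : DifferentiableAt ℝ (fun y => 2 * Real.pi * height (D.logCoord y)) (e x) :=
    (height.differentiableAt.comp _ ((D.contDiffAt_logCoord
      (height_pos_of_mem_target he (e.map_source hx))).differentiableAt (by simp))).const_mul _
  have hlocal : MDifferentiableAt 𝓘(ℝ, ℂ × ℂ) (𝓡 1)
      (Circle.exp ∘ (fun y => 2 * Real.pi * height (D.logCoord y)) ∘ e) x :=
    MDifferentiableAt.comp x
      ((contMDiff_circleExp (m := ∞)).contMDiffAt.mdifferentiableAt (by simp))
      (MDifferentiableAt.comp x hheight.mdifferentiableAt (mdifferentiableAt_atlas he hx))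
  refine hlocal.congr_of_eventuallyEq ?_
  filter_upwards [e.open_source.mem_nhds hx] with y hy
  rw [← congrArg D.fibration (e.left_inv hy), symm_eq_cover_logCoord he (e.map_source hy),
    fibration_cover]
  rfl

variable (D) in
/-- The Lee form `log α • p^* ϑ` of the Inoue surface. -/
def leeForm : DForm (ℂ × ℂ) D.S0 1 := Real.log D.α • pullback D.fibration circleForm

lemma pullback_leeForm {E : Type*} [NormedAddCommGroup E] [NormedSpace ℝ E] {M : Type*}
    [TopologicalSpace M] [ChartedSpace E M] {f : M → D.S0} {g : M → ℝ}
    (hf : MDifferentiable 𝓘(ℝ, E) 𝓘(ℝ, ℂ × ℂ) f) (hg : MDifferentiable 𝓘(ℝ, E) 𝓘(ℝ, ℝ) g)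
    (h : ∀ x, D.fibration (f x) = Circle.exp (2 * Real.pi * g x)) :
    pullback f D.leeForm = Real.log D.α • oneForm fun x => mfderiv 𝓘(ℝ, E) 𝓘(ℝ, ℝ) g x := by
  rw [leeForm, pullback_smul, ← pullback_comp mdifferentiable_fibration hf,
    show D.fibration ∘ f = _ from funext h, pullback_circleForm_circleExp hg]

lemma flatPullback_leeForm : flatPullback D.cover D.leeForm = fun _ => Real.log D.α • dy := by
  refine (pullback_leeForm mdifferentiable_cover height.differentiable.mdifferentiable
    fibration_cover).trans ?_
  simp only [mfderiv_eq_fderiv, ContinuousLinearMap.fderiv]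
  rfl

lemma pullback_proj_leeForm : pullback D.proj D.leeForm = tricerriForm := by
  have him : MDifferentiable 𝓘(ℝ, ℂ × ℂ) 𝓘(ℝ, ℝ) fun q : CH => q.1.2.im :=
    height.differentiable.mdifferentiable.comp mdifferentiable_coe_CH
  have hlogb (q : CH) : HasFDerivAt (Real.logb D.α)
      (ContinuousLinearMap.toSpanSingleton ℝ ((q.1.2.im)⁻¹ / Real.log D.α)) q.1.2.im :=
    ((Real.hasDerivAt_log (ne_of_gt q.2)).div_const _).hasFDerivAt
  rw [pullback_leeForm mdifferentiable_proj (fun q => MDifferentiableAt.comp q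
    (hlogb q).differentiableAt.mdifferentiableAt (him q)) fun _ => rfl]
  funext q
  have hcomp := mfderiv_comp q (hlogb q).differentiableAt.mdifferentiableAt (him q)
  rw [mfderiv_eq_fderiv, (hlogb q).fderiv] at hcomp
  ext v
  refine (congrArg (fun L : TangentSpace 𝓘(ℝ, ℂ × ℂ) q →L[ℝ] ℝ => Real.log D.α * L (v 0))
    hcomp).trans ?_
  change Real.log D.α * (_ * ((q.1.2.im)⁻¹ / Real.log D.α)) = (q.1.2.im)⁻¹ * _
  rw [mul_left_comm, mul_div_cancel₀ _ D.log_α_pos.ne', mul_comm]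
  rfl

lemma leeForm_mem_smoothForms : D.leeForm ∈ smoothForms (ℂ × ℂ) D.S0 1 :=
  mem_smoothForms_of_contDiff (flatPullback_leeForm ▸ contDiff_const)

lemma extD_leeForm : extD D.leeForm = 0 := by
  refine flatPullback_cover_injective ?_
  rw [← extDeriv_flatPullback contMDiff_cover leeForm_mem_smoothForms, flatPullback_leeForm]
  exact extDeriv_const _

end InoueData

end Inoue

end

theorem mainTheorem1 (D : Inoue.InoueData) :
    ∃ θ : MorseNovikov.DForm (ℂ × ℂ) D.S0 1,
      -- `θ` is the unique one-form on `S⁰` that lifts to `dw₂ / w₂` on `ℂ × ℍ`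
      (∀ θ' : MorseNovikov.DForm (ℂ × ℂ) D.S0 1,
        MorseNovikov.pullback D.proj θ' = Inoue.InoueData.tricerriForm ↔ θ' = θ) ∧
      θ ∈ MorseNovikov.smoothForms (ℂ × ℂ) D.S0 1 ∧
      MorseNovikov.extD θ = 0 ∧
      θ = Real.log D.α • MorseNovikov.pullback D.fibration Inoue.circleForm ∧
      Subsingleton (MorseNovikov.Cohomology θ 0) ∧
      Subsingleton (MorseNovikov.Cohomology θ 1) ∧
      Nonempty (MorseNovikov.Cohomology θ 2 ≃ₗ[ℝ] ℝ) ∧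
      Nonempty (MorseNovikov.Cohomology θ 3 ≃ₗ[ℝ] ℝ) ∧
      (∀ k : ℕ, 4 ≤ k → Subsingleton (MorseNovikov.Cohomology θ k)) := by
  open Inoue.InoueData in
  exact ⟨D.leeForm,
    fun _ => ⟨fun h => pullback_proj_injective (h.trans pullback_proj_leeForm.symm),
      fun h => h ▸ pullback_proj_leeForm⟩,
    leeForm_mem_smoothForms, extD_leeForm, rfl,
    subsingleton_cohomology flatPullback_leeForm (by simp) (by simp),
    subsingleton_cohomology flatPullback_leeForm (by simp) (by simp),
    nonempty_cohomology_two_equiv flatPullback_leeForm,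
    nonempty_cohomology_three_equiv flatPullback_leeForm,
    fun _ _ => subsingleton_cohomology flatPullback_leeForm (by lia) (by lia)⟩
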